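/- **Model.** A fact $\omega\in\Omega$ and a finite or infinite sequence $S=(s^1,s^2,\dots)$ of signals, with entries in a finite set $\Sigma$ and length $|S|\in\{0,1,\dots,\infty\}$, are drawn from a common prior (an arbitrary joint law). In each round $i\ge 1$ a new agent $i$ observes the public reports $m_1,\dots,m_{i-1}$ of his predecessors, privately chooses whether to work, at cost $c>0$, or to shirk, and then sends a public message $m_i$ from a finite nonempty set $M$; he may randomize, and the distribution of $m_i$ may depend on the past reports, on whether he worked, and on the signal he discovered, if any. Let $S_i$ be the sequence of signals that remain at the beginning of round $i$ ($S_1=S$). If agent $i$ works and $S_i$ is nonempty, then with probability $\lambda\in(0,1]$ he discovers an element of $S_i$, whose position has an arbitrary law depending on $i$ and $S_i$, and $S_{i+1}$ is $S_i$ with that element removed; otherwise he discovers nothing and $S_{i+1}=S_i$. Agent $i$'s utility is $V_i(m,\omega)-c\,\mathbf 1_{\{i\text{ works}\}}$, where $m=(m_1,m_2,\dots)$ and $V_i$ is measurable with values in $[-P,R]$. All agents are non-ethical: $V_i$ does not depend on $\omega$. An equilibrium is a weak perfect Bayesian equilibrium: a strategy profile together with a belief at every information set such that, at every information set, the strategy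 of the agent who moves is optimal given his belief there and the strategies of later agents, and beliefs are given by Bayes' rule at every information set reached with positive probability. An equilibrium is informative if at least one agent works with positive probability, and uninformative otherwise. **Theorem 1.** Fix $R,P\in\mathbb R$, $c>0$ and $\lambda\in(0,1]$. There exist strictly positive thresholds $\underline F^k$, $k\ge1$, depending only on $(R,P,c,\lambda)$, such that for every instance of the model with these parameters and every equilibrium of it: if $\Pr(|S|\ge k)<\underline F^k$ for some $k\ge1$, then the equilibrium is uninformative. In particular, if the support of $|S|$ is bounded, i.e. $\Pr(|S|\ge K)=0$ for some $K$, then every equilibrium is uninformative. -/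

import Mathlib

open MeasureTheory ProbabilityTheory
open scoped ENNReal

noncomputable section

set_option linter.unusedSectionVars false

namespace MediatedLearning

instance optionMeasurableSpace {A : Type*} : MeasurableSpace (Option A) := ⊤

/-- Finite or infinite sequences of signals carry the sigma-algebra generated by their entries. -/
instance seqMeasurableSpace {A : Type*} : MeasurableSpace (Stream'.Seq A) :=
  ⨆ n : ℕ, MeasurableSpace.comap (fun s : Stream'.Seq A => s.get? n) inferInstance

/-- Finite histories of reports form a discrete space. -/
instance listMeasurableSpace {M : Type*} : MeasurableSpace (List M) := ⊤

/-- What an agent privately knows after the information-seeking stage of his round: that he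
shirked, or that he worked and found nothing, or that he worked and found the signal `a`. -/
inductive Obs (A : Type*) where
  | shirk : Obs A
  | nothing : Obs A
  | found : A → Obs A

instance obsMeasurableSpace {A : Type*} : MeasurableSpace (Obs A) := ⊤

/-- The sequence `s` with its `n`-th entry (counted from `0`) removed. -/
def removeAt {A : Type*} (s : Stream'.Seq A) (n : ℕ) : Stream'.Seq A :=
  ⟨fun j => if j < n then s.get? j else s.get? (j + 1), by
    intro j hj
    have hj' : (if j < n then s.get? j else s.get? (j + 1)) = none := hj
    change (if j + 1 < n then s.get? (j + 1) else s.get? (j + 1 + 1)) = none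
    have hs : ∀ i, s.get? i = none → s.get? (i + 1) = none := fun i hi => s.2 hi
    by_cases h1 : j < n
    · rw [if_pos h1] at hj'
      split_ifs
      · exact hs _ hj'
      · exact hs _ (hs _ hj')
    · rw [if_neg h1] at hj'
      rw [if_neg (by omega)]
      exact hs _ hj'⟩

theorem get?_removeAt {A : Type*} (s : Stream'.Seq A) (n j : ℕ) :
    (removeAt s n).get? j = if j < n then s.get? j else s.get? (j + 1) := rfl

/-- Discovering the `n`-th entry of `s`. (The first case never occurs with positive
probability, since only existing entries are discovered.) -/
def discovery {A : Type*} (s : Stream'.Seq A) (n : ℕ) : Obs A :=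
  match s.get? n with
  | none => Obs.nothing
  | some a => Obs.found a

/-- The convex combination of two measures with weights `t` and `1 - t`. -/
def mix {X : Type*} [MeasurableSpace X] (t : unitInterval) (μ ν : Measure X) : Measure X :=
  ENNReal.ofReal (t : ℝ) • μ + ENNReal.ofReal (1 - (t : ℝ)) • ν

/-- An instance of the model with finite signal space `A`, finite message space `M`, fact of
interest in `Ω`, gross utilities in `[-P, R]`. Agents are numbered `0, 1, 2, …`. -/
structure Game (A M Ω : Type*) [MeasurableSpace M] [MeasurableSpace Ω] (R P : ℝ) where
  /-- the common prior: joint law of the fact and of the sequence of signals -/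
  prior : Measure (Ω × Stream'.Seq A)
  [prior_prob : IsProbabilityMeasure prior]
  /-- the law of the position of the signal found by agent `i`, given the sequence of signals
  that remain, conditional on some signal being found -/
  pick : ℕ → Kernel (Stream'.Seq A) ℕ
  [pick_markov : ∀ i, IsMarkovKernel (pick i)]
  pick_mem : ∀ i s, s ≠ Stream'.Seq.nil → ∀ᵐ n ∂(pick i s), s.get? n ≠ none
  /-- gross utility of agent `i`, a function of the infinite sequence of reports and of the fact -/
  V : ℕ → (ℕ → M) → Ω → ℝ
  V_measurable : ∀ i, Measurable (fun x : (ℕ → M) × Ω => V i x.1 x.2)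
  V_mem : ∀ i m ω, V i m ω ∈ Set.Icc (-P) R

attribute [instance] Game.prior_prob Game.pick_markov

/-- What an agent does in his round: the probability of working, and the distribution of his
report as a function of what he knows after the information-seeking stage. -/
structure Plan (A M : Type*) where
  work : unitInterval
  report : Obs A → PMF M

section Play

variable {A M Ω : Type*} [Fintype M] [MeasurableSpace M] [MeasurableSpace Ω] {R P : ℝ}

/-- Agent `i`'s utility does not depend on the fact. -/
def Game.NonEthical (G : Game A M Ω R P) (i : ℕ) : Prop :=
  ∀ m ω ω', G.V i m ω = G.V i m ω'

/-- The prior probability that there are at least `k` signals. -/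
def Game.atLeast (G : Game A M Ω R P) (k : ℕ) : ℝ :=
  G.prior.real {w | (k : ℕ∞) ≤ w.2.length'}

open Classical in
/-- Law of (what the agent learns, fact and signals that remain afterwards) if agent `i` works
when the fact and the remaining signals are `w`. -/
def Game.seek (G : Game A M Ω R P) (lam : unitInterval) (i : ℕ) (w : Ω × Stream'.Seq A) :
    Measure (Obs A × (Ω × Stream'.Seq A)) :=
  if w.2 = Stream'.Seq.nil then Measure.dirac (Obs.nothing, w)
  else mix lam ((G.pick i w.2).map (fun n => (discovery w.2 n, (w.1, removeAt w.2 n))))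
    (Measure.dirac (Obs.nothing, w))

/-- The same law if agent `i` works with probability `g`. -/
def Game.explore (G : Game A M Ω R P) (lam : unitInterval) (i : ℕ) (g : unitInterval)
    (w : Ω × Stream'.Seq A) : Measure (Obs A × (Ω × Stream'.Seq A)) :=
  mix g (G.seek lam i w) (Measure.dirac (Obs.shirk, w))

/-- A state of play at the beginning of a round: the past reports, the fact, and the signals that
remain. The agent who moves is the one whose index is the length of the history. -/
abbrev State (A M Ω : Type*) := List M × (Ω × Stream'.Seq A)

/-- One round of play under the strategy profile `σ`, which maps each public history to the plan
of the agent who moves there: the law of the next state. -/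
def Game.step (G : Game A M Ω R P) (lam : unitInterval) (σ : List M → Plan A M)
    (x : State A M Ω) : Measure (State A M Ω) :=
  (G.explore lam x.1.length (σ x.1).work x.2).bind
    (fun y => ∑ m : M, (σ x.1).report y.1 m • Measure.dirac (x.1 ++ [m], y.2))

/-! Measurability and total mass of the one-round law. -/

theorem measurable_get (n : ℕ) :
    Measurable (fun s : Stream'.Seq A => s.get? n) := by
  apply Measurable.of_comap_le
  exact le_iSup (fun n : ℕ =>
    MeasurableSpace.comap (fun s : Stream'.Seq A => s.get? n) inferInstance) n

theorem measurable_to_seq {X : Type*} [MeasurableSpace X] {f : X → Stream'.Seq A}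
    (hf : ∀ n, Measurable (fun x => (f x).get? n)) : Measurable f := by
  apply Measurable.of_le_map
  refine iSup_le fun n => ?_
  rintro _ ⟨u, hu, rfl⟩
  exact hf n hu

theorem measurable_removeAt (n : ℕ) : Measurable (fun s : Stream'.Seq A => removeAt s n) := by
  refine measurable_to_seq fun j => ?_
  by_cases h : j < n
  · have : (fun s : Stream'.Seq A => (removeAt s n).get? j) = fun s => s.get? j := by
      funext s; simp [get?_removeAt, h]
    rw [this]; exact measurable_get j
  · have : (fun s : Stream'.Seq A => (removeAt s n).get? j) = fun s => s.get? (j + 1) := by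
      funext s; simp [get?_removeAt, h]
    rw [this]; exact measurable_get (j + 1)

theorem measurable_discovery (n : ℕ) : Measurable (fun s : Stream'.Seq A => discovery s n) := by
  have h : Measurable (fun o : Option A => (match o with
    | none => Obs.nothing
    | some a => Obs.found a : Obs A)) := measurable_from_top
  exact h.comp (measurable_get n)

theorem measurableSet_nil :
    MeasurableSet {w : Ω × Stream'.Seq A | w.2 = Stream'.Seq.nil} := by
  have : {w : Ω × Stream'.Seq A | w.2 = Stream'.Seq.nil}
      = (fun w : Ω × Stream'.Seq A => w.2.get? 0) ⁻¹' {none} := by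
    ext w
    constructor
    · intro h
      have h' : w.2 = Stream'.Seq.nil := h
      simp [h']
    · intro h
      have h0 : w.2.get? 0 = none := h
      change w.2 = Stream'.Seq.nil
      ext1 n
      rw [Stream'.Seq.get?_nil]
      exact Stream'.Seq.le_stable _ (Nat.zero_le n) h0
  rw [this]
  exact ((measurable_get 0).comp measurable_snd) trivial

theorem measurable_mix {X Y : Type*} [MeasurableSpace X] [MeasurableSpace Y] (t : unitInterval)
    {μ ν : X → Measure Y} (hμ : Measurable μ) (hν : Measurable ν) :
    Measurable (fun x => mix t (μ x) (ν x)) := by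
  refine Measure.measurable_of_measurable_coe _ fun s hs => ?_
  simp only [mix, Measure.coe_add, Measure.coe_smul, Pi.add_apply, Pi.smul_apply, smul_eq_mul]
  exact ((Measure.measurable_coe hs).comp hμ |>.const_mul _).add
    ((Measure.measurable_coe hs).comp hν |>.const_mul _)

theorem mix_prob {X : Type*} [MeasurableSpace X] (t : unitInterval) (μ ν : Measure X)
    [IsProbabilityMeasure μ] [IsProbabilityMeasure ν] : IsProbabilityMeasure (mix t μ ν) := by
  constructor
  simp only [mix, Measure.coe_add, Measure.coe_smul, Pi.add_apply, Pi.smul_apply, smul_eq_mul,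
    measure_univ, mul_one]
  rw [← ENNReal.ofReal_add t.2.1 (sub_nonneg.2 t.2.2)]
  simp

theorem measurable_seek (G : Game A M Ω R P) (lam : unitInterval) (i : ℕ) :
    Measurable (G.seek lam i) := by
  classical
  refine Measurable.ite measurableSet_nil
    (Measure.measurable_dirac.comp (measurable_const.prodMk measurable_id)) ?_
  refine measurable_mix lam ?_
    (Measure.measurable_dirac.comp (measurable_const.prodMk measurable_id))
  have hg : Measurable (fun z : (Ω × Stream'.Seq A) × ℕ =>
      ((discovery z.1.2 z.2, (z.1.1, removeAt z.1.2 z.2)) : Obs A × (Ω × Stream'.Seq A))) := by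
    refine measurable_from_prod_countable_left fun n => ?_
    exact ((measurable_discovery n).comp measurable_snd).prodMk
      (measurable_fst.prodMk ((measurable_removeAt n).comp measurable_snd))
  have h := (Kernel.map (Kernel.prod (Kernel.id : Kernel (Ω × Stream'.Seq A) (Ω × Stream'.Seq A))
    ((G.pick i).comap (Prod.snd : Ω × Stream'.Seq A → _) measurable_snd)) (fun z =>
      ((discovery z.1.2 z.2, (z.1.1, removeAt z.1.2 z.2)) : Obs A × (Ω × Stream'.Seq A)))).measurable
  convert h using 2 with w
  rw [Kernel.map_apply _ hg, Kernel.prod_apply, Kernel.id_apply, Kernel.comap_apply,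
    Measure.dirac_prod, Measure.map_map hg measurable_prodMk_left]
  rfl

theorem measurable_explore (G : Game A M Ω R P) (lam : unitInterval) (i : ℕ) (g : unitInterval) :
    Measurable (G.explore lam i g) :=
  measurable_mix g (measurable_seek G lam i)
    (Measure.measurable_dirac.comp (measurable_const.prodMk measurable_id))

theorem explore_prob (G : Game A M Ω R P) (lam : unitInterval) (i : ℕ) (g : unitInterval)
    (w : Ω × Stream'.Seq A) : IsProbabilityMeasure (G.explore lam i g w) := by
  classical
  have : IsProbabilityMeasure (G.seek lam i w) := by
    unfold Game.seek
    split_ifs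
    · infer_instance
    · have : IsProbabilityMeasure ((G.pick i w.2).map
          (fun n => ((discovery w.2 n, (w.1, removeAt w.2 n)) : Obs A × (Ω × Stream'.Seq A)))) :=
        Measure.isProbabilityMeasure_map measurable_from_top.aemeasurable
      exact mix_prob _ _ _
  exact mix_prob _ _ _

theorem measurable_send (p : Plan A M) (h : List M) :
    Measurable (fun y : Obs A × (Ω × Stream'.Seq A) =>
      ∑ m : M, p.report y.1 m • Measure.dirac ((h ++ [m], y.2) : State A M Ω)) := by
  refine Measure.measurable_of_measurable_coe _ fun s hs => ?_
  simp only [Measure.coe_finsetSum, Measure.coe_smul, Finset.sum_apply, Pi.smul_apply,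
    smul_eq_mul]
  refine Finset.measurable_sum _ fun m _ => Measurable.mul ?_ ?_
  · exact (measurable_from_top (f := fun o : Obs A => p.report o m)).comp measurable_fst
  · exact (Measure.measurable_coe hs).comp
      (Measure.measurable_dirac.comp (measurable_const.prodMk measurable_snd))

theorem send_prob (p : Plan A M) (h : List M) (y : Obs A × (Ω × Stream'.Seq A)) :
    IsProbabilityMeasure
      (∑ m : M, p.report y.1 m • Measure.dirac ((h ++ [m], y.2) : State A M Ω)) := by
  constructor
  simp only [Measure.coe_finsetSum, Measure.coe_smul, Finset.sum_apply, Pi.smul_apply,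
    smul_eq_mul, measure_univ, mul_one]
  have h1 := (p.report y.1).tsum_coe
  rwa [tsum_fintype] at h1

theorem measurable_step (G : Game A M Ω R P) (lam : unitInterval) (σ : List M → Plan A M) :
    Measurable (G.step lam σ) := by
  have : MeasurableSingletonClass (List M) := ⟨fun _ => trivial⟩
  refine measurable_from_prod_countable_right fun h => ?_
  exact (Measure.measurable_bind' (measurable_send (σ h) h)).comp
    (measurable_explore G lam h.length (σ h).work)

theorem step_prob (G : Game A M Ω R P) (lam : unitInterval) (σ : List M → Plan A M)
    (x : State A M Ω) : IsProbabilityMeasure (G.step lam σ x) := by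
  have := explore_prob G lam x.1.length (σ x.1).work x.2
  exact isProbabilityMeasure_bind (measurable_send (σ x.1) x.1).aemeasurable
    (Filter.Eventually.of_forall fun y => send_prob (σ x.1) x.1 y)

/-- The one-round law as a Markov kernel. -/
def Game.stepKernel (G : Game A M Ω R P) (lam : unitInterval) (σ : List M → Plan A M) :
    Kernel (State A M Ω) (State A M Ω) :=
  ⟨G.step lam σ, measurable_step G lam σ⟩

instance (G : Game A M Ω R P) (lam : unitInterval) (σ : List M → Plan A M) :
    IsMarkovKernel (G.stepKernel lam σ) :=
  ⟨fun x => step_prob G lam σ x⟩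

/-- The law of the whole sequence of future states when play starts from the state `x` and all
agents from then on follow `σ`: the Markov chain with transition kernel `stepKernel`. -/
def Game.pathLaw (G : Game A M Ω R P) (lam : unitInterval) (σ : List M → Plan A M)
    (x : State A M Ω) : Measure (ℕ → State A M Ω) :=
  Kernel.traj (X := fun _ => State A M Ω)
    (fun n => (G.stepKernel lam σ).comap (fun y => y ⟨n, Finset.mem_Iic.2 le_rfl⟩)
      (measurable_pi_apply _)) 0 (fun _ => x)

/-- The infinite sequence of reports along a path of states. The state reached after `j + 1` rounds
records more than `j` reports, so that the default value is never used. -/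
def reports [Nonempty M] (x : ℕ → State A M Ω) : ℕ → M :=
  fun j => (x (j + 1)).1.getD j (Classical.arbitrary M)

/-- Expected gross utility of agent `i` when play continues from the state `(h, w)`. -/
def Game.value [Nonempty M] (G : Game A M Ω R P) (lam : unitInterval) (σ : List M → Plan A M)
    (i : ℕ) (h : List M) (w : Ω × Stream'.Seq A) : ℝ :=
  ∫ x, G.V i (reports x) w.1 ∂(G.pathLaw lam σ (h, w))

/-- Effort cost, paid exactly when the agent works. -/
def effort (c : ℝ) : Obs A → ℝ
  | Obs.shirk => 0
  | _ => c

/-- Expected utility of the agent who moves at the history `h`, at the moment of reporting, if he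
has observed `o`, holds the belief `ν` on the fact and the signals that remain, and draws his report
from `q`, while later agents follow `σ`. -/
def Game.reportPayoff [Nonempty M] (G : Game A M Ω R P) (c : ℝ) (lam : unitInterval)
    (σ : List M → Plan A M) (h : List M) (o : Obs A) (ν : Measure (Ω × Stream'.Seq A))
    (q : PMF M) : ℝ :=
  ∫ w, (∑ m : M, (q m).toReal * G.value lam σ h.length (h ++ [m]) w - effort c o) ∂ν

/-- Expected utility of the agent who moves at the history `h`, at the beginning of his round, if he
holds the belief `μ` on the fact and the signals that remain and uses the plan `p`, while later
agents follow `σ`. -/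
def Game.planPayoff [Nonempty M] (G : Game A M Ω R P) (c : ℝ) (lam : unitInterval)
    (σ : List M → Plan A M) (h : List M) (μ : Measure (Ω × Stream'.Seq A)) (p : Plan A M) : ℝ :=
  ∫ y, (∑ m : M, (p.report y.1 m).toReal * G.value lam σ h.length (h ++ [m]) y.2 - effort c y.1)
    ∂(μ.bind (G.explore lam h.length p.work))

/-- The law of the state at the beginning of round `n` (rounds counted from `0`). -/
def Game.stageLaw (G : Game A M Ω R P) (lam : unitInterval) (σ : List M → Plan A M) :
    ℕ → Measure (State A M Ω)
  | 0 => G.prior.map (fun w => ([], w))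
  | n + 1 => (Game.stageLaw G lam σ n).bind (G.step lam σ)

/-- A strategy profile with a system of beliefs: a belief on the fact and the signals that remain
at each information set, that is, at each public history `h` (beginning of a round) and at each pair
of a public history and a private observation (reporting stage of that round). -/
structure Assessment (A M Ω : Type*) [MeasurableSpace Ω] where
  strategy : List M → Plan A M
  belief : List M → Measure (Ω × Stream'.Seq A)
  reportBelief : List M → Obs A → Measure (Ω × Stream'.Seq A)
  [belief_prob : ∀ h, IsProbabilityMeasure (belief h)]
  [reportBelief_prob : ∀ h o, IsProbabilityMeasure (reportBelief h o)]

attribute [instance] Assessment.belief_prob Assessment.reportBelief_prob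

/-- The public history `h` is reached with positive probability. -/
def Game.OnPath (G : Game A M Ω R P) (lam : unitInterval) (σ : List M → Plan A M)
    (h : List M) : Prop :=
  G.stageLaw lam σ h.length (Prod.fst ⁻¹' {h}) ≠ 0

/-- Weak perfect Bayesian equilibrium: sequential rationality at every information set given the
beliefs held there, and beliefs given by Bayes' rule at every information set that is reached with
positive probability. -/
structure Game.IsWeakPBE [Nonempty M] (G : Game A M Ω R P) (c : ℝ) (lam : unitInterval)
    (a : Assessment A M Ω) : Prop where
  rational : ∀ (h : List M) (p : Plan A M),
    G.planPayoff c lam a.strategy h (a.belief h) p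
      ≤ G.planPayoff c lam a.strategy h (a.belief h) (a.strategy h)
  rational_report : ∀ (h : List M) (o : Obs A) (q : PMF M),
    G.reportPayoff c lam a.strategy h o (a.reportBelief h o) q
      ≤ G.reportPayoff c lam a.strategy h o (a.reportBelief h o) ((a.strategy h).report o)
  bayes : ∀ h : List M, G.OnPath lam a.strategy h →
    a.belief h = ((G.stageLaw lam a.strategy h.length)[|Prod.fst ⁻¹' {h}]).map Prod.snd
  bayes_report : ∀ (h : List M) (o : Obs A), G.OnPath lam a.strategy h →
    (a.belief h).bind (G.explore lam h.length (a.strategy h).work) (Prod.fst ⁻¹' {o}) ≠ 0 →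
    a.reportBelief h o =
      (((a.belief h).bind
        (G.explore lam h.length (a.strategy h).work))[|Prod.fst ⁻¹' {o}]).map Prod.snd

/-- The probability that agent `i` works. -/
def Game.workProb (G : Game A M Ω R P) (lam : unitInterval) (σ : List M → Plan A M)
    (i : ℕ) : ℝ≥0∞ :=
  ∫⁻ x, ENNReal.ofReal ((σ x.1).work : ℝ) ∂(G.stageLaw lam σ i)

/-- At least one agent works with positive probability. -/
def Game.Informative (G : Game A M Ω R P) (lam : unitInterval) (a : Assessment A M Ω) : Prop :=
  ∃ i : ℕ, 0 < G.workProb lam a.strategy i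

end Play

end MediatedLearning

end

/-!
Let every agent who works toss a coin that is favourable with probability `lam`; he discovers a
signal if and only if the coin is favourable and some signal is left. Tossing the coin when no
signal is left changes nothing, and makes "some coin is favourable" an event whose occurrence is
not affected by the signals until it happens for the first time. The probability `peril h` that it
happens somewhere after the history `h` therefore bounds the influence of the remaining signals on
the law of all later reports. As a non-ethical agent cares for reports only, his continuation value
depends on the signals by at most `(R + P) * peril h`
(`Game.value_le_add`).

Suppose an agent works at `h`. By optimality, what he gets after a favourable coin exceeds by at
least `c` what he gets after an unfavourable one, and what any report sent without work gives.
Hence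
* some signal is left with probability at least `c / (R + P)`, since otherwise the coin makes no
  difference (`Game.IsWeakPBE.le_moreThan_zero`);
* after a favourable coin, he sends with probability at least `c / (R + P)` a report at which the
  peril is positive, since among the other reports there is a best one, which is available without
  work and has a value that does not depend on the signals
  (`Game.IsWeakPBE.le_sum_luckyReport`);
* the expected peril after a favourable coin is at least `c / (2 * (R + P))`
  (`Game.IsWeakPBE.le_sum_luckyReport_mul_peril`).

By induction on `j`, at every reached history with positive peril more than `j` signals are left
with conditional probability at least some `F > 0` that depends on the parameters only
(`exists_threshold`). The case `j = 0` is the first incentive fact, applied to the first agent who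
works. For the step, suppose that at some such history more than `j + 1` signals are very unlikely.
By the third fact there is a similar history at which the peril is bounded below
(`Game.IsWeakPBE.exists_le_peril`). Apart from a negligible event, at most `j + 1` signals are left
there, so that a discovery destroys the event that more than `j` are left. If the conditional
probability `f` of this event did not fall by a definite factor at any later history with positive
peril, then almost every unit of probability that reaches such histories would have to do so
without a favourable coin. But by the second fact, favourable coins lead to such histories a
definite fraction of the time, and their total probability is bounded below by the peril: a
contradiction (`Game.IsWeakPBE.mul_detect_le`, `Game.IsWeakPBE.exists_massMore_le`). So the
conditional probability of more than `j` signals does fall by a factor, and iterating this a bounded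
number of times pushes it below the threshold for `j`.

If an equilibrium is informative, the peril at the empty history is positive
(`Game.Informative.peril_pos`), and the bound at the empty history is the theorem.
-/

noncomputable section

set_option linter.unusedSectionVars false

namespace MediatedLearning

/-! ### Lucky rounds -/

section

variable {A M Ω : Type*} [Fintype M] [MeasurableSpace M] [MeasurableSpace Ω] {R P : ℝ}

theorem measurable_obs_fun {X : Type*} [MeasurableSpace X] (f : Obs A → X) : Measurable f :=
  measurable_from_top

open Classical in
/-- Law of (what agent `i` learns, fact and signals that remain afterwards) if agent `i` works and
the `lam`-coin of his search falls on the favourable side. The coin is also tossed when no signal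
is left, in which case its outcome makes no difference. -/
def Game.success (G : Game A M Ω R P) (i : ℕ) (w : Ω × Stream'.Seq A) :
    Measure (Obs A × (Ω × Stream'.Seq A)) :=
  if w.2 = Stream'.Seq.nil then Measure.dirac (Obs.nothing, w)
  else (G.pick i w.2).map (fun n => (discovery w.2 n, (w.1, removeAt w.2 n)))

theorem mix_self {X : Type*} [MeasurableSpace X] (t : unitInterval) (μ : Measure X) :
    mix t μ μ = μ := by
  rw [mix, ← add_smul, ← ENNReal.ofReal_add t.2.1 (sub_nonneg.2 t.2.2)]
  simp

theorem Game.seek_eq_mix (G : Game A M Ω R P) (lam : unitInterval) (i : ℕ)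
    (w : Ω × Stream'.Seq A) :
    G.seek lam i w = mix lam (G.success i w) (Measure.dirac (Obs.nothing, w)) := by
  unfold Game.seek Game.success
  split_ifs
  · rw [mix_self]
  · rfl

theorem Game.seek_one (G : Game A M Ω R P) (i : ℕ) : G.seek 1 i = G.success i := by
  funext w
  rw [G.seek_eq_mix]
  simp [mix]

theorem Game.measurable_success (G : Game A M Ω R P) (i : ℕ) : Measurable (G.success i) := by
  rw [← G.seek_one]
  exact measurable_seek G 1 i

instance (G : Game A M Ω R P) (i : ℕ) (w : Ω × Stream'.Seq A) :
    IsProbabilityMeasure (G.success i w) := by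
  unfold Game.success
  split_ifs
  · infer_instance
  · exact Measure.isProbabilityMeasure_map measurable_from_top.aemeasurable

instance (G : Game A M Ω R P) (i : ℕ) (μ : Measure (Ω × Stream'.Seq A))
    [IsProbabilityMeasure μ] : IsProbabilityMeasure (μ.bind (G.success i)) :=
  isProbabilityMeasure_bind (G.measurable_success i).aemeasurable
    (Filter.Eventually.of_forall fun _ => inferInstance)

theorem bind_mix {X Y : Type*} [MeasurableSpace X] [MeasurableSpace Y] (t : unitInterval)
    {κ η : X → Measure Y} (hκ : Measurable κ) (hη : Measurable η) (μ : Measure X) :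
    μ.bind (fun x => mix t (κ x) (η x)) = mix t (μ.bind κ) (μ.bind η) := by
  ext s hs
  rw [Measure.bind_apply hs (measurable_mix t hκ hη).aemeasurable]
  simp only [mix, Measure.coe_add, Measure.coe_smul, Pi.add_apply, Pi.smul_apply, smul_eq_mul]
  have h1 : Measurable (fun x => κ x s) := (Measure.measurable_coe hs).comp hκ
  have h2 : Measurable (fun x => η x s) := (Measure.measurable_coe hs).comp hη
  rw [lintegral_add_left (h1.const_mul _), lintegral_const_mul _ h1, lintegral_const_mul _ h2,
    Measure.bind_apply hs hκ.aemeasurable, Measure.bind_apply hs hη.aemeasurable]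

theorem Game.explore_eq_mix (G : Game A M Ω R P) (lam : unitInterval) (i : ℕ) (g : unitInterval)
    (w : Ω × Stream'.Seq A) :
    G.explore lam i g w = mix g (mix lam (G.success i w) (Measure.dirac (Obs.nothing, w)))
      (Measure.dirac (Obs.shirk, w)) := by
  rw [Game.explore, G.seek_eq_mix]

theorem measurable_tag (o : Obs A) :
    Measurable (fun w : Ω × Stream'.Seq A => (o, w)) :=
  measurable_const.prodMk measurable_id

theorem Game.bind_explore (G : Game A M Ω R P) (lam : unitInterval) (i : ℕ) (g : unitInterval)
    (μ : Measure (Ω × Stream'.Seq A)) :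
    μ.bind (G.explore lam i g) = mix g (mix lam (μ.bind (G.success i))
      (μ.map (fun w => (Obs.nothing, w)))) (μ.map (fun w => (Obs.shirk, w))) := by
  have hd : ∀ o : Obs A, Measurable
      (fun w : Ω × Stream'.Seq A => (Measure.dirac (o, w) : Measure (Obs A × _))) :=
    fun o => Measure.measurable_dirac.comp (measurable_tag o)
  have : G.explore lam i g = fun w => mix g (mix lam (G.success i w)
      (Measure.dirac (Obs.nothing, w))) (Measure.dirac (Obs.shirk, w)) := by
    funext w; exact G.explore_eq_mix lam i g w
  rw [this, bind_mix g (measurable_mix lam (G.measurable_success i) (hd _)) (hd _),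
    bind_mix lam (G.measurable_success i) (hd _),
    Measure.bind_dirac_eq_map μ (measurable_tag _), Measure.bind_dirac_eq_map μ (measurable_tag _)]

/-! ### The sets `{|S| > j}` -/

/-- The event that more than `j` signals remain. -/
def moreThan (A Ω : Type*) (j : ℕ) : Set (Ω × Stream'.Seq A) := {w | w.2.get? j ≠ none}

theorem measurableSet_moreThan (j : ℕ) : MeasurableSet (moreThan A Ω j) :=
  ((measurable_get j).comp measurable_snd)
    (MeasurableSpace.measurableSet_top : MeasurableSet[⊤] {o : Option A | o ≠ none})

theorem moreThan_succ_subset (j : ℕ) : moreThan A Ω (j + 1) ⊆ moreThan A Ω j := by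
  intro w hw hj
  exact hw (w.2.2 hj)

theorem natCast_le_length'_iff {s : Stream'.Seq A} {j : ℕ} :
    ((j + 1 : ℕ) : ℕ∞) ≤ s.length' ↔ s.get? j ≠ none := by
  rw [Nat.cast_add, Nat.cast_one, ENat.add_one_le_iff (ENat.natCast_ne_top j),
    Stream'.Seq.lt_length'_iff, Option.ne_none_iff_exists']
  rfl

theorem Game.atLeast_succ (G : Game A M Ω R P) (j : ℕ) :
    G.atLeast (j + 1) = G.prior.real (moreThan A Ω j) := by
  unfold Game.atLeast moreThan
  congr 1
  ext w
  exact natCast_le_length'_iff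

theorem get?_removeAt_eq_none {s : Stream'.Seq A} {n j : ℕ} (hn : s.get? n ≠ none)
    (hj : s.get? (j + 1) = none) : (removeAt s n).get? j = none := by
  rw [get?_removeAt]
  split_ifs with h
  · exact absurd (Stream'.Seq.le_stable s (by omega : j + 1 ≤ n) hj) hn
  · exact hj

/-- After a favourable coin, at most `j` signals are left if there were at most `j + 1`. -/
theorem Game.success_moreThan (G : Game A M Ω R P) (i j : ℕ) {w : Ω × Stream'.Seq A}
    (hw : w ∉ moreThan A Ω (j + 1)) :
    G.success i w (Prod.snd ⁻¹' moreThan A Ω j) = 0 := by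
  have hw' : w.2.get? (j + 1) = none := by simpa [moreThan] using hw
  unfold Game.success
  split_ifs with h
  · rw [Measure.dirac_apply' _ (measurable_snd (measurableSet_moreThan j))]
    simp [moreThan, h]
  · rw [Measure.map_apply measurable_from_top (measurable_snd (measurableSet_moreThan j))]
    have := G.pick_mem i w.2 h
    refine measure_mono_null ?_ (ae_iff.1 this)
    intro n hn hn'
    exact hn (get?_removeAt_eq_none hn' hw')

/-! ### Propagation of the belief along the tree of reports -/

/-- The probability that agent `h.length`, facing the history `h`, sends the report `m` without a
favourable coin: because he shirks, or because he works and the coin is unfavourable. It does not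
depend on the signals that remain. -/
def quiet (lam : unitInterval) (σ : List M → Plan A M) (h : List M) (m : M) : ℝ≥0∞ :=
  ENNReal.ofReal (1 - ((σ h).work : ℝ)) * (σ h).report Obs.shirk m +
    ENNReal.ofReal (σ h).work * (ENNReal.ofReal (1 - (lam : ℝ)) * (σ h).report Obs.nothing m)

/-- Image of a measure `μ` on facts and remaining signals if agent `h.length` works at the history
`h`, his coin is favourable, and he sends the report `m`. -/
def Game.echo (G : Game A M Ω R P) (σ : List M → Plan A M) (h : List M) (m : M)
    (μ : Measure (Ω × Stream'.Seq A)) : Measure (Ω × Stream'.Seq A) :=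
  ((μ.bind (G.success h.length)).withDensity (fun y => (σ h).report y.1 m)).map Prod.snd

theorem measurable_report (p : Plan A M) (m : M) :
    Measurable (fun y : Obs A × (Ω × Stream'.Seq A) => p.report y.1 m) :=
  (measurable_obs_fun (fun o : Obs A => p.report o m)).comp measurable_fst

theorem Game.echo_apply (G : Game A M Ω R P) (σ : List M → Plan A M) (h : List M) (m : M)
    (μ : Measure (Ω × Stream'.Seq A)) {s : Set (Ω × Stream'.Seq A)} (hs : MeasurableSet s) :
    G.echo σ h m μ s = ∫⁻ w, ∫⁻ y, (σ h).report y.1 m * (Prod.snd ⁻¹' s).indicator 1 y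
      ∂(G.success h.length w) ∂μ := by
  have hm : MeasurableSet (Prod.snd ⁻¹' s : Set (Obs A × (Ω × Stream'.Seq A))) := measurable_snd hs
  have hmeas : Measurable (fun y : Obs A × (Ω × Stream'.Seq A) =>
      (σ h).report y.1 m * (Prod.snd ⁻¹' s).indicator 1 y) :=
    (measurable_report (σ h) m).mul (measurable_one.indicator hm)
  rw [Game.echo, Measure.map_apply measurable_snd hs, withDensity_apply _ hm,
    ← lintegral_indicator hm]
  have : (Prod.snd ⁻¹' s : Set (Obs A × (Ω × Stream'.Seq A))).indicator
      (fun y => (σ h).report y.1 m) =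
      fun y => (σ h).report y.1 m * (Prod.snd ⁻¹' s).indicator 1 y := by
    funext y
    by_cases hy : y ∈ (Prod.snd ⁻¹' s : Set (Obs A × (Ω × Stream'.Seq A)))
    · simp only [Set.indicator_of_mem hy, Pi.one_apply, mul_one]
    · simp only [Set.indicator_of_notMem hy, mul_zero]
  rw [this, Measure.lintegral_bind (G.measurable_success _).aemeasurable hmeas.aemeasurable]

theorem Game.echo_add (G : Game A M Ω R P) (σ : List M → Plan A M) (h : List M) (m : M)
    (μ ν : Measure (Ω × Stream'.Seq A)) :
    G.echo σ h m (μ + ν) = G.echo σ h m μ + G.echo σ h m ν := by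
  ext s hs
  simp [G.echo_apply σ h m _ hs, lintegral_add_measure]

theorem Game.echo_smul (G : Game A M Ω R P) (σ : List M → Plan A M) (h : List M) (m : M)
    (t : ℝ≥0∞) (μ : Measure (Ω × Stream'.Seq A)) :
    G.echo σ h m (t • μ) = t • G.echo σ h m μ := by
  ext s hs
  simp [G.echo_apply σ h m _ hs, lintegral_smul_measure]

theorem sum_report (p : Plan A M) (o : Obs A) : ∑ m : M, p.report o m = 1 := by
  have h1 := (p.report o).tsum_coe
  rwa [tsum_fintype] at h1

theorem Game.echo_univ (G : Game A M Ω R P) (σ : List M → Plan A M) (h : List M) (m : M)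
    (μ : Measure (Ω × Stream'.Seq A)) :
    G.echo σ h m μ Set.univ = ∫⁻ y, (σ h).report y.1 m ∂(μ.bind (G.success h.length)) := by
  rw [Game.echo, Measure.map_apply measurable_snd MeasurableSet.univ, Set.preimage_univ,
    withDensity_apply _ MeasurableSet.univ, Measure.restrict_univ]

theorem Game.bind_success_univ (G : Game A M Ω R P) (i : ℕ) (μ : Measure (Ω × Stream'.Seq A)) :
    μ.bind (G.success i) Set.univ = μ Set.univ := by
  rw [Measure.bind_apply MeasurableSet.univ (G.measurable_success i).aemeasurable]
  simp

theorem Game.sum_echo_univ (G : Game A M Ω R P) (σ : List M → Plan A M) (h : List M)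
    (μ : Measure (Ω × Stream'.Seq A)) :
    ∑ m : M, G.echo σ h m μ Set.univ = μ Set.univ := by
  simp only [G.echo_univ]
  rw [← lintegral_finsetSum _ fun m _ => measurable_report (σ h) m]
  simp only [sum_report, lintegral_one, G.bind_success_univ]

theorem Game.echo_moreThan (G : Game A M Ω R P) (σ : List M → Plan A M) (h : List M) (m : M)
    (μ : Measure (Ω × Stream'.Seq A)) (j : ℕ) (hμ : μ (moreThan A Ω (j + 1)) = 0) :
    G.echo σ h m μ (moreThan A Ω j) = 0 := by
  have hm : MeasurableSet (Prod.snd ⁻¹' moreThan A Ω j : Set (Obs A × (Ω × Stream'.Seq A))) :=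
    measurable_snd (measurableSet_moreThan j)
  rw [Game.echo, Measure.map_apply measurable_snd (measurableSet_moreThan j)]
  refine withDensity_absolutelyContinuous _ _ ?_
  rw [Measure.bind_apply hm (G.measurable_success _).aemeasurable]
  refine (lintegral_eq_zero_iff ((Measure.measurable_coe hm).comp (G.measurable_success _))).2 ?_
  have : ∀ᵐ w ∂μ, w ∉ moreThan A Ω (j + 1) := measure_eq_zero_iff_ae_notMem.1 hμ
  filter_upwards [this] with w hw using G.success_moreThan _ j hw

theorem sum_quiet (lam : unitInterval) (σ : List M → Plan A M) (h : List M) :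
    ∑ m : M, quiet lam σ h m + ENNReal.ofReal (σ h).work * ENNReal.ofReal lam = 1 := by
  unfold quiet
  rw [Finset.sum_add_distrib, ← Finset.mul_sum, ← Finset.mul_sum, ← Finset.mul_sum, sum_report,
    sum_report, mul_one, mul_one, add_assoc, ← mul_add,
    ← ENNReal.ofReal_add (sub_nonneg.2 lam.2.2) lam.2.1, sub_add_cancel, ENNReal.ofReal_one,
    mul_one, ← ENNReal.ofReal_add (sub_nonneg.2 (σ h).work.2.2) (σ h).work.2.1, sub_add_cancel,
    ENNReal.ofReal_one]

/-- The joint law of the fact and the remaining signals at the history `h`, restricted to the event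
that this history is reached. Its total mass is the probability of reaching `h`. -/
def Game.node (G : Game A M Ω R P) (lam : unitInterval) (σ : List M → Plan A M) (h : List M) :
    Measure (Ω × Stream'.Seq A) :=
  ((G.stageLaw lam σ h.length).restrict (Prod.fst ⁻¹' {h})).map Prod.snd

theorem measurableSet_fst_preimage {X : Type*} [MeasurableSpace X] (s : Set (List M)) :
    MeasurableSet (Prod.fst ⁻¹' s : Set (List M × X)) :=
  measurable_fst (MeasurableSpace.measurableSet_top : MeasurableSet[⊤] s)

/-- One round of the process of reports: the probability that the state `x` is followed by
the history `h ++ [m]` with fact and remaining signals in `s`. -/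
theorem Game.step_append (G : Game A M Ω R P) (lam : unitInterval) (σ : List M → Plan A M)
    (h : List M) (m : M) {s : Set (Ω × Stream'.Seq A)} (hs : MeasurableSet s)
    (x : State A M Ω) :
    G.step lam σ x (Prod.fst ⁻¹' {h ++ [m]} ∩ Prod.snd ⁻¹' s) =
      (Prod.fst ⁻¹' {h} : Set (State A M Ω)).indicator (fun x => quiet lam σ h m * s.indicator 1 x.2
        + ENNReal.ofReal (σ h).work * ENNReal.ofReal lam *
          ∫⁻ y, (σ h).report y.1 m * (Prod.snd ⁻¹' s).indicator 1 y
            ∂(G.success h.length x.2)) x := by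
  classical
  have hS : MeasurableSet (Prod.fst ⁻¹' {h ++ [m]} ∩ Prod.snd ⁻¹' s : Set (State A M Ω)) :=
    (measurableSet_fst_preimage _).inter (measurable_snd hs)
  rw [Game.step, Measure.bind_apply hS (measurable_send (σ x.1) x.1).aemeasurable]
  simp only [Measure.coe_finsetSum, Measure.coe_smul, Finset.sum_apply, Pi.smul_apply,
    smul_eq_mul, Measure.dirac_apply' _ hS]
  by_cases hx : x.1 = h
  · rw [Set.indicator_of_mem (by exact hx)]
    subst hx
    have key : ∀ y : Obs A × (Ω × Stream'.Seq A),
        ∑ m' : M, (σ x.1).report y.1 m' *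
          (Prod.fst ⁻¹' {x.1 ++ [m]} ∩ Prod.snd ⁻¹' s : Set (State A M Ω)).indicator 1
            (x.1 ++ [m'], y.2) =
        (σ x.1).report y.1 m * (Prod.snd ⁻¹' s).indicator 1 y := by
      intro y
      rw [Finset.sum_eq_single m]
      · congr 1
        by_cases hy : y.2 ∈ s <;> simp [Set.indicator, hy]
      · intro m' _ hm'
        rw [Set.indicator_of_notMem, mul_zero]
        simp [hm']
      · simp
    have hmeas : Measurable (fun y : Obs A × (Ω × Stream'.Seq A) =>
        (σ x.1).report y.1 m * (Prod.snd ⁻¹' s).indicator 1 y) :=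
      (measurable_report (σ x.1) m).mul (measurable_one.indicator (measurable_snd hs))
    simp only [key]
    rw [G.explore_eq_mix]
    simp only [mix]
    rw [lintegral_add_measure, lintegral_smul_measure, lintegral_smul_measure,
      lintegral_add_measure, lintegral_smul_measure, lintegral_smul_measure,
      lintegral_dirac' _ hmeas, lintegral_dirac' _ hmeas]
    have hi : ∀ o : Obs A, (Prod.snd ⁻¹' s : Set (Obs A × (Ω × Stream'.Seq A))).indicator
        (1 : Obs A × (Ω × Stream'.Seq A) → ℝ≥0∞) (o, x.2) = s.indicator 1 x.2 := fun o => by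
      by_cases hy : x.2 ∈ s <;> simp [Set.indicator, hy]
    simp only [hi, quiet, smul_eq_mul]
    ring
  · rw [Set.indicator_of_notMem (by exact hx)]
    refine (lintegral_eq_zero_iff' ?_).2 ?_
    · refine Measurable.aemeasurable (Finset.measurable_sum _ fun m' _ => ?_)
      refine (measurable_report (σ x.1) m').mul ?_
      exact (measurable_one.indicator hS).comp (measurable_const.prodMk measurable_snd)
    · refine Filter.Eventually.of_forall fun y => ?_
      refine Finset.sum_eq_zero fun m' _ => ?_
      rw [Set.indicator_of_notMem, mul_zero]
      simp [hx]

theorem Game.node_apply (G : Game A M Ω R P) (lam : unitInterval) (σ : List M → Plan A M)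
    (h : List M) {s : Set (Ω × Stream'.Seq A)} (hs : MeasurableSet s) :
    G.node lam σ h s =
      G.stageLaw lam σ h.length (Prod.fst ⁻¹' {h} ∩ Prod.snd ⁻¹' s) := by
  rw [Game.node, Measure.map_apply measurable_snd hs,
    Measure.restrict_apply (measurable_snd hs), Set.inter_comm]

/-- The measure at `h ++ [m]` consists of a multiple of the measure at `h`, which carries no news
about the signals, and of the contribution of a favourable coin. -/
theorem Game.node_append (G : Game A M Ω R P) (lam : unitInterval) (σ : List M → Plan A M)
    (h : List M) (m : M) :
    G.node lam σ (h ++ [m]) = quiet lam σ h m • G.node lam σ h +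
      (ENNReal.ofReal (σ h).work * ENNReal.ofReal lam) • G.echo σ h m (G.node lam σ h) := by
  ext s hs
  have hS : MeasurableSet (Prod.fst ⁻¹' {h ++ [m]} ∩ Prod.snd ⁻¹' s : Set (State A M Ω)) :=
    (measurableSet_fst_preimage _).inter (measurable_snd hs)
  have h1 : Measurable (s.indicator (1 : Ω × Stream'.Seq A → ℝ≥0∞)) := measurable_one.indicator hs
  have h2 : Measurable (fun w : Ω × Stream'.Seq A => ∫⁻ y, (σ h).report y.1 m *
      (Prod.snd ⁻¹' s).indicator 1 y ∂(G.success h.length w)) :=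
    (Measure.measurable_lintegral ((measurable_report (σ h) m).mul
      (measurable_one.indicator (measurable_snd hs)))).comp (G.measurable_success _)
  rw [G.node_apply lam σ _ hs]
  simp only [List.length_append, List.length_cons, List.length_nil, zero_add, Game.stageLaw]
  rw [Measure.bind_apply hS (measurable_step G lam σ).aemeasurable]
  simp only [G.step_append lam σ h m hs]
  rw [lintegral_indicator (measurableSet_fst_preimage _)]
  simp only [Measure.coe_add, Measure.coe_smul, Pi.add_apply, Pi.smul_apply, smul_eq_mul]
  rw [G.echo_apply σ h m _ hs]
  have h3 : ∫⁻ x : State A M Ω, (quiet lam σ h m * s.indicator 1 x.2 + ENNReal.ofReal (σ h).work *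
      ENNReal.ofReal lam * ∫⁻ y, (σ h).report y.1 m * (Prod.snd ⁻¹' s).indicator 1 y
        ∂(G.success h.length x.2)) ∂((G.stageLaw lam σ h.length).restrict (Prod.fst ⁻¹' {h})) =
      ∫⁻ w, (quiet lam σ h m * s.indicator 1 w + ENNReal.ofReal (σ h).work *
      ENNReal.ofReal lam * ∫⁻ y, (σ h).report y.1 m * (Prod.snd ⁻¹' s).indicator 1 y
        ∂(G.success h.length w)) ∂(G.node lam σ h) := by
    have h4 : Measurable (fun w : Ω × Stream'.Seq A => quiet lam σ h m * s.indicator 1 w +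
        ENNReal.ofReal (σ h).work * ENNReal.ofReal lam * ∫⁻ y, (σ h).report y.1 m *
          (Prod.snd ⁻¹' s).indicator 1 y ∂(G.success h.length w)) :=
      (h1.const_mul _).add (h2.const_mul _)
    rw [Game.node, lintegral_map h4 measurable_snd]
  rw [h3, lintegral_add_left (h1.const_mul _), lintegral_const_mul _ h1, lintegral_const_mul _ h2,
    lintegral_indicator_one hs]

theorem Game.node_nil (G : Game A M Ω R P) (lam : unitInterval) (σ : List M → Plan A M) :
    G.node lam σ [] = G.prior := by
  ext s hs
  rw [G.node_apply lam σ _ hs]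
  have hm : Measurable (fun w : Ω × Stream'.Seq A => (([], w) : State A M Ω)) :=
    measurable_const.prodMk measurable_id
  rw [List.length_nil, Game.stageLaw, Measure.map_apply hm
    ((measurableSet_fst_preimage _).inter (measurable_snd hs))]
  congr 1
  ext w
  simp

instance (G : Game A M Ω R P) (lam : unitInterval) (σ : List M → Plan A M) (n : ℕ) :
    IsProbabilityMeasure (G.stageLaw lam σ n) := by
  induction n with
  | zero =>
    exact Measure.isProbabilityMeasure_map (measurable_const.prodMk measurable_id).aemeasurable
  | succ n ih =>
    exact isProbabilityMeasure_bind (measurable_step G lam σ).aemeasurable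
      (Filter.Eventually.of_forall fun x => step_prob G lam σ x)

instance (G : Game A M Ω R P) (lam : unitInterval) (σ : List M → Plan A M) (h : List M) :
    IsFiniteMeasure (G.node lam σ h) := by
  unfold Game.node
  infer_instance

theorem Game.onPath_iff (G : Game A M Ω R P) (lam : unitInterval) (σ : List M → Plan A M)
    (h : List M) : G.OnPath lam σ h ↔ G.node lam σ h Set.univ ≠ 0 := by
  rw [Game.OnPath, G.node_apply lam σ h MeasurableSet.univ, Set.preimage_univ, Set.inter_univ]

theorem Game.IsWeakPBE.node_eq [Nonempty M] {G : Game A M Ω R P} {c : ℝ} {lam : unitInterval}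
    {a : Assessment A M Ω} (ha : G.IsWeakPBE c lam a) {h : List M}
    (hh : G.OnPath lam a.strategy h) :
    G.node lam a.strategy h = G.node lam a.strategy h Set.univ • a.belief h := by
  rw [ha.bayes h hh, ProbabilityTheory.cond, Measure.map_smul, smul_smul,
    G.node_apply lam _ h MeasurableSet.univ, Set.preimage_univ, Set.inter_univ,
    ENNReal.mul_inv_cancel hh (measure_ne_top _ _), one_smul]
  rfl

end

/-! ### Comparison of measures on an algebra of sets -/

section

variable {A M Ω : Type*} [Fintype M] [MeasurableSpace M] [MeasurableSpace Ω] {R P : ℝ}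

theorem measureReal_le_add_of_isSetAlgebra {X : Type*} [hX : MeasurableSpace X] {μ ν : Measure X}
    [IsFiniteMeasure μ] [IsFiniteMeasure ν] {𝒜 : Set (Set X)} (h𝒜 : IsSetAlgebra 𝒜)
    (hgen : hX = MeasurableSpace.generateFrom 𝒜) {d : ℝ}
    (h : ∀ t ∈ 𝒜, μ.real t ≤ ν.real t + d) {s : Set X} (hs : MeasurableSet s) :
    μ.real s ≤ ν.real s + d := by
  refine le_of_forall_pos_le_add fun ε hε => ?_
  obtain ⟨t, ht, hst⟩ := (Measure.MeasureDense.of_generateFrom_isSetAlgebra_finite (μ + ν) h𝒜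
    hgen).approx s hs (measure_ne_top _ _) ε hε
  have h1 : (μ + ν).real (symmDiff s t) < ε := by
    rw [measureReal_def]
    exact (ENNReal.lt_ofReal_iff_toReal_lt (measure_ne_top _ _)).1 hst
  rw [measureReal_add_apply] at h1
  have h2 : μ.real s ≤ μ.real t + μ.real (symmDiff s t) := by
    refine (measureReal_mono ?_).trans (measureReal_union_le _ _)
    intro x hx
    by_cases hxt : x ∈ t
    · exact Or.inl hxt
    · exact Or.inr (Or.inl ⟨hx, hxt⟩)
  have h3 : ν.real t ≤ ν.real s + ν.real (symmDiff s t) := by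
    refine (measureReal_mono ?_).trans (measureReal_union_le _ _)
    intro x hx
    by_cases hxt : x ∈ s
    · exact Or.inl hxt
    · exact Or.inr (Or.inr ⟨hx, hxt⟩)
  have := h t ht
  linarith

theorem integrable_of_mem_Icc {X : Type*} [MeasurableSpace X] {μ : Measure X} [IsFiniteMeasure μ]
    {f : X → ℝ} (hf : Measurable f) {lo hi : ℝ} (hb : ∀ x, f x ∈ Set.Icc lo hi) :
    Integrable f μ :=
  Integrable.of_mem_Icc lo hi hf.aemeasurable (Filter.Eventually.of_forall hb)

theorem integral_le_add_of_measureReal_le_add {X : Type*} [MeasurableSpace X] {μ ν : Measure X}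
    [IsProbabilityMeasure μ] [IsProbabilityMeasure ν] {d : ℝ}
    (h : ∀ s, MeasurableSet s → μ.real s ≤ ν.real s + d) {f : X → ℝ} (hf : Measurable f)
    {lo hi : ℝ} (hle : lo ≤ hi) (hb : ∀ x, f x ∈ Set.Icc lo hi) :
    ∫ x, f x ∂μ ≤ ∫ x, f x ∂ν + (hi - lo) * d := by
  have key : ∀ ρ : Measure X, IsProbabilityMeasure ρ →
      ∫ x, f x ∂ρ = lo + ∫ t in Set.Ioc 0 (hi - lo), ρ.real {x | t ≤ f x - lo} := by
    intro ρ _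
    have hi' : Integrable f ρ := integrable_of_mem_Icc hf hb
    have h0 : ∫ x, (f x - lo) ∂ρ = ∫ x, f x ∂ρ - lo := by
      rw [integral_sub hi' (integrable_const _)]; simp
    have h1 := Integrable.integral_eq_integral_Ioc_meas_le (μ := ρ) (f := fun x => f x - lo)
      (M := hi - lo) (hi'.sub (integrable_const _))
      (Filter.Eventually.of_forall fun x => sub_nonneg.2 (hb x).1)
      (Filter.Eventually.of_forall fun x => sub_le_sub_right (hb x).2 lo)
    linarith
  have hint : ∀ ρ : Measure X, IsProbabilityMeasure ρ → IntegrableOn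
      (fun t => ρ.real {x | t ≤ f x - lo}) (Set.Ioc 0 (hi - lo)) := by
    intro ρ _
    have ha : Antitone (fun t => ρ.real {x | t ≤ f x - lo}) := fun s t hst =>
      measureReal_mono fun x hx => le_trans hst hx
    exact (integrable_of_mem_Icc (lo := 0) (hi := 1) ha.measurable
      fun t => ⟨measureReal_nonneg, measureReal_le_one⟩)
  rw [key μ inferInstance, key ν inferInstance]
  have h2 : ∫ t in Set.Ioc 0 (hi - lo), μ.real {x | t ≤ f x - lo} ≤
      ∫ t in Set.Ioc 0 (hi - lo), (ν.real {x | t ≤ f x - lo} + d) := by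
    refine integral_mono (hint μ inferInstance) ((hint ν inferInstance).add (integrable_const _)) ?_
    intro t
    exact h _ (measurableSet_le measurable_const (hf.sub measurable_const))
  rw [integral_add (hint ν inferInstance) (integrable_const _)] at h2
  have h3 : ∫ _ in Set.Ioc 0 (hi - lo), d = (hi - lo) * d := by
    rw [setIntegral_const, measureReal_def, Real.volume_Ioc, sub_zero,
      ENNReal.toReal_ofReal (sub_nonneg.2 hle), smul_eq_mul]
  linarith

/-! ### The path law of the reports -/

theorem Game.lintegral_pathLaw (G : Game A M Ω R P) (lam : unitInterval) (σ : List M → Plan A M)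
    (x : State A M Ω) (n : ℕ) {f : State A M Ω × State A M Ω → ℝ≥0∞} (hf : Measurable f) :
    ∫⁻ y, f (y n, y (n + 1)) ∂(G.pathLaw lam σ x) =
      ∫⁻ y, ∫⁻ z, f (y n, z) ∂(G.step lam σ (y n)) ∂(G.pathLaw lam σ x) := by
  set κ : (n : ℕ) → Kernel (Π _ : Finset.Iic n, State A M Ω) (State A M Ω) := fun n =>
    (G.stepKernel lam σ).comap (fun y => y ⟨n, Finset.mem_Iic.2 le_rfl⟩) (measurable_pi_apply _)
    with hκ
  have hpath : G.pathLaw lam σ x =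
      Kernel.traj (X := fun _ => State A M Ω) κ 0 (fun _ => x) := rfl
  have hmap := fun b => Kernel.traj_map_frestrictLe_apply (X := fun _ => State A M Ω) (κ := κ) 0 b
    (fun _ => x)
  have hF : Measurable (fun u : Π _ : Finset.Iic (n + 1), State A M Ω =>
      f (u ⟨n, Finset.mem_Iic.2 n.le_succ⟩, u ⟨n + 1, Finset.mem_Iic.2 le_rfl⟩)) :=
    hf.comp ((measurable_pi_apply _).prodMk (measurable_pi_apply _))
  have hinner : Measurable (fun s : State A M Ω => ∫⁻ z, f (s, z) ∂(G.step lam σ s)) :=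
    Measurable.lintegral_kernel_prod_right (κ := G.stepKernel lam σ) hf
  have hG : Measurable (fun v : Π _ : Finset.Iic n, State A M Ω =>
      ∫⁻ z, f (v ⟨n, Finset.mem_Iic.2 le_rfl⟩, z)
        ∂(G.step lam σ (v ⟨n, Finset.mem_Iic.2 le_rfl⟩))) :=
    hinner.comp (measurable_pi_apply _)
  have hL : ∫⁻ y, f (y n, y (n + 1)) ∂(G.pathLaw lam σ x) =
      ∫⁻ u, f (u ⟨n, Finset.mem_Iic.2 n.le_succ⟩, u ⟨n + 1, Finset.mem_Iic.2 le_rfl⟩)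
        ∂(Kernel.partialTraj (X := fun _ => State A M Ω) κ 0 (n + 1) (fun _ => x)) := by
    rw [← hmap, lintegral_map hF (Preorder.measurable_frestrictLe _), hpath]
    rfl
  have hR : ∫⁻ y, ∫⁻ z, f (y n, z) ∂(G.step lam σ (y n)) ∂(G.pathLaw lam σ x) =
      ∫⁻ v, ∫⁻ z, f (v ⟨n, Finset.mem_Iic.2 le_rfl⟩, z)
        ∂(G.step lam σ (v ⟨n, Finset.mem_Iic.2 le_rfl⟩))
        ∂(Kernel.partialTraj (X := fun _ => State A M Ω) κ 0 n (fun _ => x)) := by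
    rw [← hmap, lintegral_map hG (Preorder.measurable_frestrictLe _), hpath]
    rfl
  rw [hL, hR, Kernel.partialTraj_succ_eq_comp (Nat.zero_le n), Kernel.lintegral_comp _ _ _ hF]
  refine lintegral_congr fun v => ?_
  have hsing : Measurable (MeasurableEquiv.piSingleton (X := fun _ => State A M Ω) n) :=
    MeasurableEquiv.measurable _
  have hprod : Measurable (IicProdIoc (X := fun _ => State A M Ω) n (n + 1)) :=
    measurable_IicProdIoc
  rw [Kernel.partialTraj_succ_self, Kernel.lintegral_map _ hprod _ hF]
  refine (Kernel.lintegral_id_prod (hF.comp hprod) _ _).trans ?_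
  refine (Kernel.lintegral_map _ hsing _ ((hF.comp hprod).comp measurable_prodMk_left)).trans ?_
  refine lintegral_congr fun z => ?_
  simp only [Function.comp_apply]
  have h1 : IicProdIoc (X := fun _ => State A M Ω) n (n + 1)
      (v, MeasurableEquiv.piSingleton (X := fun _ => State A M Ω) n z)
        ⟨n, Finset.mem_Iic.2 n.le_succ⟩ = v ⟨n, Finset.mem_Iic.2 le_rfl⟩ := by
    simp [IicProdIoc]
  have h2 : IicProdIoc (X := fun _ => State A M Ω) n (n + 1)
      (v, MeasurableEquiv.piSingleton (X := fun _ => State A M Ω) n z)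
        ⟨n + 1, Finset.mem_Iic.2 le_rfl⟩ = z := by
    simp [IicProdIoc, MeasurableEquiv.piSingleton]
  rw [h1, h2]

theorem Game.pathLaw_zero (G : Game A M Ω R P) (lam : unitInterval) (σ : List M → Plan A M)
    (x : State A M Ω) (f : State A M Ω → ℝ≥0∞) (hf : Measurable f) :
    ∫⁻ y, f (y 0) ∂(G.pathLaw lam σ x) = f x := by
  set κ : (n : ℕ) → Kernel (Π _ : Finset.Iic n, State A M Ω) (State A M Ω) := fun n =>
    (G.stepKernel lam σ).comap (fun y => y ⟨n, Finset.mem_Iic.2 le_rfl⟩) (measurable_pi_apply _)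
    with hκ
  have hpath : G.pathLaw lam σ x =
      Kernel.traj (X := fun _ => State A M Ω) κ 0 (fun _ => x) := rfl
  have hF : Measurable (fun u : Π _ : Finset.Iic 0, State A M Ω =>
      f (u ⟨0, Finset.mem_Iic.2 le_rfl⟩)) := hf.comp (measurable_pi_apply _)
  have : ∫⁻ y, f (y 0) ∂(G.pathLaw lam σ x) = ∫⁻ u, f (u ⟨0, Finset.mem_Iic.2 le_rfl⟩)
        ∂(Kernel.partialTraj (X := fun _ => State A M Ω) κ 0 0 (fun _ => x)) := by
    rw [← Kernel.traj_map_frestrictLe_apply, lintegral_map hF (Preorder.measurable_frestrictLe _),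
      hpath]
    rfl
  rw [this, Kernel.partialTraj_self, Kernel.id_apply, lintegral_dirac' _ hF]

instance (G : Game A M Ω R P) (lam : unitInterval) (σ : List M → Plan A M) (x : State A M Ω) :
    IsProbabilityMeasure (G.pathLaw lam σ x) := by
  unfold Game.pathLaw
  infer_instance

end

/-! ### Play without favourable coins -/

section

variable {A M Ω : Type*} [Fintype M] [MeasurableSpace M] [MeasurableSpace Ω] {R P : ℝ}

/-- One round of play without a favourable coin, as an operator on functions of the history. -/
def mute (lam : unitInterval) (σ : List M → Plan A M) (φ : List M → ℝ≥0∞) (h : List M) : ℝ≥0∞ :=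
  ∑ m : M, quiet lam σ h m * φ (h ++ [m])

/-- The probability, at the history `h`, that no coin is favourable in the next `n` rounds. -/
def survive (lam : unitInterval) (σ : List M → Plan A M) (n : ℕ) (h : List M) : ℝ≥0∞ :=
  (mute lam σ)^[n] 1 h

/-- The probability, at the history `h`, that some coin is favourable in the next `n` rounds. If
signals are left, this is the probability that one of them is discovered in these rounds. -/
def detect (lam : unitInterval) (σ : List M → Plan A M) (n : ℕ) (h : List M) : ℝ :=
  1 - (survive lam σ n h).toReal

theorem mute_add (lam : unitInterval) (σ : List M → Plan A M) (φ ψ : List M → ℝ≥0∞) :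
    mute lam σ (φ + ψ) = mute lam σ φ + mute lam σ ψ := by
  funext h
  simp [mute, mul_add, Finset.sum_add_distrib]

theorem iterate_mute_add (lam : unitInterval) (σ : List M → Plan A M) (φ ψ : List M → ℝ≥0∞)
    (n : ℕ) : (mute lam σ)^[n] (φ + ψ) = (mute lam σ)^[n] φ + (mute lam σ)^[n] ψ := by
  induction n generalizing φ ψ with
  | zero => rfl
  | succ n ih => rw [Function.iterate_succ_apply, mute_add, ih]; rfl

theorem survive_zero (lam : unitInterval) (σ : List M → Plan A M) (h : List M) :
    survive lam σ 0 h = 1 := rfl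

theorem survive_succ (lam : unitInterval) (σ : List M → Plan A M) (n : ℕ) (h : List M) :
    survive lam σ (n + 1) h = ∑ m : M, quiet lam σ h m * survive lam σ n (h ++ [m]) := by
  unfold survive
  rw [Function.iterate_succ_apply']
  rfl

theorem quiet_le_one (lam : unitInterval) (σ : List M → Plan A M) (h : List M) (m : M) :
    quiet lam σ h m ≤ 1 := by
  rw [← sum_quiet lam σ h]
  exact (Finset.single_le_sum (f := fun m => quiet lam σ h m) (fun _ _ => zero_le)
    (Finset.mem_univ m)).trans le_self_add

theorem quiet_ne_top (lam : unitInterval) (σ : List M → Plan A M) (h : List M) (m : M) :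
    quiet lam σ h m ≠ ∞ := ((quiet_le_one lam σ h m).trans_lt ENNReal.one_lt_top).ne

theorem survive_le_one (lam : unitInterval) (σ : List M → Plan A M) (n : ℕ) (h : List M) :
    survive lam σ n h ≤ 1 := by
  induction n generalizing h with
  | zero => exact le_rfl
  | succ n ih =>
    rw [survive_succ]
    calc _ ≤ ∑ m : M, quiet lam σ h m * 1 := by gcongr; exact ih _
      _ ≤ 1 := by
        simp only [mul_one]
        rw [← sum_quiet lam σ h]
        exact le_self_add

theorem survive_ne_top (lam : unitInterval) (σ : List M → Plan A M) (n : ℕ) (h : List M) :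
    survive lam σ n h ≠ ∞ := ((survive_le_one lam σ n h).trans_lt ENNReal.one_lt_top).ne

theorem detect_zero (lam : unitInterval) (σ : List M → Plan A M) (h : List M) :
    detect lam σ 0 h = 0 := by
  simp [detect, survive_zero]

theorem sum_quiet_toReal (lam : unitInterval) (σ : List M → Plan A M) (h : List M) :
    ∑ m : M, (quiet lam σ h m).toReal + (σ h).work * lam = 1 := by
  have := congrArg ENNReal.toReal (sum_quiet lam σ h)
  rwa [ENNReal.toReal_add, ENNReal.toReal_sum, ENNReal.toReal_mul,
    ENNReal.toReal_ofReal (σ h).work.2.1, ENNReal.toReal_ofReal lam.2.1,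
    ENNReal.toReal_one] at this
  · exact fun m _ => quiet_ne_top lam σ h m
  · exact ENNReal.sum_ne_top.2 fun m _ => quiet_ne_top lam σ h m
  · exact ENNReal.mul_ne_top ENNReal.ofReal_ne_top ENNReal.ofReal_ne_top

theorem detect_succ (lam : unitInterval) (σ : List M → Plan A M) (n : ℕ) (h : List M) :
    detect lam σ (n + 1) h =
      (σ h).work * lam + ∑ m : M, (quiet lam σ h m).toReal * detect lam σ n (h ++ [m]) := by
  unfold detect
  rw [survive_succ, ENNReal.toReal_sum fun m _ =>
    ENNReal.mul_ne_top (quiet_ne_top _ _ _ _) (survive_ne_top _ _ _ _)]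
  simp only [ENNReal.toReal_mul, mul_sub, mul_one, Finset.sum_sub_distrib]
  linarith [sum_quiet_toReal lam σ h]

theorem detect_nonneg (lam : unitInterval) (σ : List M → Plan A M) (n : ℕ) (h : List M) :
    0 ≤ detect lam σ n h :=
  sub_nonneg.2 (by simpa using ENNReal.toReal_mono ENNReal.one_ne_top (survive_le_one lam σ n h))

theorem detect_le_one (lam : unitInterval) (σ : List M → Plan A M) (n : ℕ) (h : List M) :
    detect lam σ n h ≤ 1 := sub_le_self _ ENNReal.toReal_nonneg

/-- The limit of `detect`: the probability, at the history `h`, that some later coin is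
favourable. -/
def peril (lam : unitInterval) (σ : List M → Plan A M) (h : List M) : ℝ :=
  ⨆ n, detect lam σ n h

theorem detect_le_peril (lam : unitInterval) (σ : List M → Plan A M) (n : ℕ) (h : List M) :
    detect lam σ n h ≤ peril lam σ h :=
  le_ciSup (f := fun n => detect lam σ n h)
    ⟨1, by rintro _ ⟨n, rfl⟩; exact detect_le_one lam σ n h⟩ n

theorem peril_nonneg (lam : unitInterval) (σ : List M → Plan A M) (h : List M) :
    0 ≤ peril lam σ h :=
  (detect_nonneg lam σ 0 h).trans (detect_le_peril lam σ 0 h)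

theorem peril_le_one (lam : unitInterval) (σ : List M → Plan A M) (h : List M) :
    peril lam σ h ≤ 1 := ciSup_le fun n => detect_le_one lam σ n h

theorem exists_lt_detect {lam : unitInterval} {σ : List M → Plan A M} {h : List M} {t : ℝ}
    (ht : t < peril lam σ h) : ∃ n, t < detect lam σ n h :=
  exists_lt_of_lt_ciSup ht

/-! ### The remaining signals affect the reports only through favourable coins -/

theorem Game.mute_le_lintegral_step (G : Game A M Ω R P) (lam : unitInterval)
    (σ : List M → Plan A M) (φ : List M → ℝ≥0∞) (x : State A M Ω) :
    mute lam σ φ x.1 ≤ ∫⁻ z, φ z.1 ∂(G.step lam σ x) := by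
  have hφ : Measurable (fun z : State A M Ω => φ z.1) :=
    (measurable_from_top (f := φ)).comp measurable_fst
  have hsum : Measurable (fun y : Obs A × (Ω × Stream'.Seq A) =>
      ∑ m : M, (σ x.1).report y.1 m * φ (x.1 ++ [m])) :=
    Finset.measurable_sum _ fun m _ => (measurable_report (σ x.1) m).mul_const _
  rw [Game.step, Measure.lintegral_bind (measurable_send (σ x.1) x.1).aemeasurable
    hφ.aemeasurable]
  simp only [lintegral_finsetSum_measure, lintegral_smul_measure, lintegral_dirac' _ hφ,
    smul_eq_mul]
  rw [G.explore_eq_mix]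
  simp only [mix]
  rw [lintegral_add_measure, lintegral_smul_measure, lintegral_smul_measure,
    lintegral_add_measure, lintegral_smul_measure, lintegral_smul_measure,
    lintegral_dirac' _ hsum, lintegral_dirac' _ hsum]
  simp only [smul_eq_mul, mute, quiet, add_mul, Finset.sum_add_distrib, mul_assoc,
    ← Finset.mul_sum, mul_add]
  rw [add_comm]
  gcongr
  exact le_add_self

theorem Game.iterate_mute_le_lintegral_pathLaw (G : Game A M Ω R P) (lam : unitInterval)
    (σ : List M → Plan A M) (φ : List M → ℝ≥0∞) (x : State A M Ω) (n : ℕ) :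
    (mute lam σ)^[n] φ x.1 ≤ ∫⁻ y, φ (y n).1 ∂(G.pathLaw lam σ x) := by
  induction n generalizing φ with
  | zero =>
    have hφ : Measurable (fun z : State A M Ω => φ z.1) :=
      (measurable_from_top (f := φ)).comp measurable_fst
    exact (G.pathLaw_zero lam σ x (fun z => φ z.1) hφ).ge
  | succ n ih =>
    rw [Function.iterate_succ_apply]
    refine (ih (mute lam σ φ)).trans ?_
    have hφ : Measurable (fun z : State A M Ω × State A M Ω => φ z.2.1) :=
      (measurable_from_top (f := φ)).comp (measurable_fst.comp measurable_snd)
    rw [G.lintegral_pathLaw lam σ x n hφ]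
    exact lintegral_mono fun y => G.mute_le_lintegral_step lam σ φ (y n)

theorem Game.step_extends (G : Game A M Ω R P) (lam : unitInterval) (σ : List M → Plan A M)
    (x : State A M Ω) : G.step lam σ x {z | ¬ ∃ m, z.1 = x.1 ++ [m]} = 0 := by
  have hS : MeasurableSet {z : State A M Ω | ¬ ∃ m, z.1 = x.1 ++ [m]} :=
    measurableSet_fst_preimage {l | ¬ ∃ m, l = x.1 ++ [m]}
  rw [Game.step, Measure.bind_apply hS (measurable_send (σ x.1) x.1).aemeasurable]
  refine (lintegral_eq_zero_iff
    ((Measure.measurable_coe hS).comp (measurable_send (σ x.1) x.1))).2 ?_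
  refine Filter.Eventually.of_forall fun y => ?_
  change (∑ m : M, (σ x.1).report y.1 m • Measure.dirac ((x.1 ++ [m], y.2) : State A M Ω))
    {z | ¬ ∃ m, z.1 = x.1 ++ [m]} = 0
  simp only [Measure.coe_finsetSum, Measure.coe_smul, Finset.sum_apply, Pi.smul_apply,
    smul_eq_mul, Measure.dirac_apply' _ hS]
  refine Finset.sum_eq_zero fun m _ => ?_
  have hm : ((x.1 ++ [m], y.2) : State A M Ω) ∉ {z : State A M Ω | ¬ ∃ m, z.1 = x.1 ++ [m]} :=
    fun hne => hne ⟨m, rfl⟩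
  rw [Set.indicator_of_notMem hm, mul_zero]

theorem Game.ae_pathLaw_extends (G : Game A M Ω R P) (lam : unitInterval)
    (σ : List M → Plan A M) (x : State A M Ω) :
    ∀ᵐ y ∂(G.pathLaw lam σ x), (y 0).1 = x.1 ∧ ∀ n, ∃ m, (y (n + 1)).1 = (y n).1 ++ [m] := by
  have : Countable (List M) := inferInstance
  have : MeasurableSingletonClass (List M) := ⟨fun _ => trivial⟩
  refine Filter.Eventually.and ?_ (ae_all_iff.2 fun n => ?_)
  · have hS : MeasurableSet (Prod.fst ⁻¹' {x.1}ᶜ : Set (State A M Ω)) :=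
      measurableSet_fst_preimage _
    have h1 := G.pathLaw_zero lam σ x _ (measurable_one.indicator hS)
    rw [Set.indicator_of_notMem (by simp)] at h1
    have h2 := (lintegral_eq_zero_iff
      ((measurable_one.indicator hS).comp (measurable_pi_apply 0))).1 h1
    filter_upwards [h2] with y hy
    by_contra hne
    have : (Prod.fst ⁻¹' {x.1}ᶜ : Set (State A M Ω)).indicator (1 : State A M Ω → ℝ≥0∞) (y 0)
        = 1 := Set.indicator_of_mem (by simpa using hne) _
    simp only [Pi.zero_apply, Function.comp_apply] at hy
    rw [this] at hy
    exact one_ne_zero hy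
  · have hS : MeasurableSet {z : State A M Ω × State A M Ω | ¬ ∃ m, z.2.1 = z.1.1 ++ [m]} := by
      have hm : Measurable (fun z : State A M Ω × State A M Ω => (z.1.1, z.2.1)) :=
        (measurable_fst.comp measurable_fst).prodMk (measurable_fst.comp measurable_snd)
      exact hm (MeasurableSet.of_discrete (s := {l : List M × List M | ¬ ∃ m, l.2 = l.1 ++ [m]}))
    have h1 := G.lintegral_pathLaw lam σ x n (measurable_one.indicator hS)
    have h0 : ∀ y : ℕ → State A M Ω, ∫⁻ z, {z : State A M Ω × State A M Ω |
        ¬ ∃ m, z.2.1 = z.1.1 ++ [m]}.indicator 1 (y n, z) ∂(G.step lam σ (y n)) = 0 := by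
      intro y
      have hS' : MeasurableSet {z : State A M Ω | ¬ ∃ m, z.1 = (y n).1 ++ [m]} :=
        measurableSet_fst_preimage {l | ¬ ∃ m, l = (y n).1 ++ [m]}
      rw [← G.step_extends lam σ (y n), ← lintegral_indicator_one hS']
      rfl
    simp only [h0, lintegral_zero] at h1
    have h2 := (lintegral_eq_zero_iff ((measurable_one.indicator hS).comp
      ((measurable_pi_apply n).prodMk (measurable_pi_apply (n + 1))))).1 h1
    filter_upwards [h2] with y hy
    by_contra hne
    have : {z : State A M Ω × State A M Ω | ¬ ∃ m, z.2.1 = z.1.1 ++ [m]}.indicator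
        (1 : State A M Ω × State A M Ω → ℝ≥0∞) (y n, y (n + 1)) = 1 :=
      Set.indicator_of_mem hne _
    simp only [Pi.zero_apply, Function.comp_apply] at hy
    rw [this] at hy
    exact one_ne_zero hy

variable [Nonempty M]

/-- The sequence of reports that begins with the list `l`, continued arbitrarily. -/
def extend (l : List M) : ℕ → M := fun j => l.getD j (Classical.arbitrary M)

theorem Game.ae_reports_eq (G : Game A M Ω R P) (lam : unitInterval)
    (σ : List M → Plan A M) (x : State A M Ω) :
    ∀ᵐ y ∂(G.pathLaw lam σ x), ∀ n j, j < n → reports y j = extend (y n).1 j := by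
  filter_upwards [G.ae_pathLaw_extends lam σ x] with y hy n j hjn
  have hlen : ∀ k, k ≤ (y k).1.length := by
    intro k
    induction k with
    | zero => exact Nat.zero_le _
    | succ k ih => obtain ⟨m, hm⟩ := hy.2 k; rw [hm]; simpa using ih
  induction n, hjn using Nat.le_induction with
  | base => rfl
  | succ n hn ih =>
    rw [ih]
    obtain ⟨m, hm⟩ := hy.2 n
    unfold extend
    rw [hm, List.getD_append _ _ _ _ (lt_of_lt_of_le hn (hlen n))]

theorem measurable_reports :
    Measurable (reports : (ℕ → State A M Ω) → ℕ → M) := by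
  refine measurable_pi_lambda _ fun j => ?_
  exact (measurable_from_top (f := fun l : List M => l.getD j (Classical.arbitrary M))).comp
    (measurable_fst.comp (measurable_pi_apply (j + 1)))

/-- For an event determined by finitely many reports, the remaining signals matter at most by the
probability of a favourable coin in the rounds concerned. -/
theorem Game.measureReal_reports_cylinder_le (G : Game A M Ω R P) (lam : unitInterval)
    (σ : List M → Plan A M) (h : List M) (w w' : Ω × Stream'.Seq A) {t : Set (ℕ → M)}
    (ht : t ∈ measurableCylinders (fun _ : ℕ => M)) :
    ((G.pathLaw lam σ (h, w)).map reports).real t ≤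
      ((G.pathLaw lam σ (h, w')).map reports).real t + peril lam σ h := by
  obtain ⟨s, S, hS, rfl⟩ := (mem_measurableCylinders t).1 ht
  obtain ⟨n, hn⟩ : ∃ n, ∀ j ∈ s, j < n :=
    ⟨s.sup id + 1, fun j hj => Nat.lt_succ_of_le (Finset.le_sup (f := id) hj)⟩
  set t : Set (ℕ → M) := cylinder s S with htdef
  have htm : MeasurableSet t := hS.cylinder s
  have hdet : ∀ u v : ℕ → M, (∀ j < n, u j = v j) → (u ∈ t ↔ v ∈ t) := by
    intro u v huv
    have : s.restrict u = s.restrict v := by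
      funext j
      exact huv j (hn j j.2)
    rw [htdef, mem_cylinder, mem_cylinder, this]
  have hlow : ∀ (u : Set (ℕ → M)), MeasurableSet u →
      (∀ a b : ℕ → M, (∀ j < n, a j = b j) → (a ∈ u ↔ b ∈ u)) → ∀ v : Ω × Stream'.Seq A,
      (mute lam σ)^[n] ((extend ⁻¹' u).indicator 1) h ≤
        ((G.pathLaw lam σ (h, v)).map reports) u := by
    intro u hu hud v
    refine (G.iterate_mute_le_lintegral_pathLaw lam σ _ (h, v) n).trans ?_
    rw [← lintegral_indicator_one hu, lintegral_map (measurable_one.indicator hu)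
      measurable_reports]
    refine lintegral_mono_ae ?_
    filter_upwards [G.ae_reports_eq lam σ (h, v)] with y hy
    by_cases hyu : extend (y n).1 ∈ u
    · rw [Set.indicator_of_mem ((hud _ _ (hy n)).2 hyu)]
      exact Set.indicator_le_self' (fun _ _ => zero_le) _
    · rw [Set.indicator_of_notMem (by exact hyu)]
      exact zero_le
  have hsum : (mute lam σ)^[n] ((extend ⁻¹' t).indicator 1) h +
      (mute lam σ)^[n] ((extend ⁻¹' tᶜ).indicator 1) h = survive lam σ n h := by
    have := congrFun (iterate_mute_add lam σ ((extend ⁻¹' t).indicator 1)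
      ((extend ⁻¹' tᶜ).indicator 1) n) h
    rw [Pi.add_apply] at this
    rw [← this, Set.preimage_compl, Set.indicator_self_add_compl]
    rfl
  have h1 := hlow t htm hdet w'
  have h2 := hlow tᶜ htm.compl (fun a b hab => not_congr (hdet a b hab)) w
  have hp : ∀ v, IsProbabilityMeasure ((G.pathLaw lam σ (h, v)).map reports) := fun v =>
    Measure.isProbabilityMeasure_map measurable_reports.aemeasurable
  have := hp w
  have := hp w'
  have h1' := ENNReal.toReal_mono (measure_ne_top _ _) h1
  have h2' := ENNReal.toReal_mono (measure_ne_top _ _) h2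
  have hs' := congrArg ENNReal.toReal hsum
  rw [ENNReal.toReal_add (ne_top_of_le_ne_top (measure_ne_top _ _) h1)
    (ne_top_of_le_ne_top (measure_ne_top _ _) h2)] at hs'
  have h3 := probReal_compl_eq_one_sub (μ := (G.pathLaw lam σ (h, w)).map reports) htm
  have h4 := detect_le_peril lam σ n h
  unfold detect at h4
  rw [← measureReal_def] at h1' h2'
  linarith

theorem Game.measureReal_reports_le (G : Game A M Ω R P) (lam : unitInterval)
    (σ : List M → Plan A M) (h : List M) (w w' : Ω × Stream'.Seq A) {t : Set (ℕ → M)}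
    (ht : MeasurableSet t) :
    ((G.pathLaw lam σ (h, w)).map reports).real t ≤
      ((G.pathLaw lam σ (h, w')).map reports).real t + peril lam σ h := by
  have hp : ∀ v, IsProbabilityMeasure ((G.pathLaw lam σ (h, v)).map reports) := fun v =>
    Measure.isProbabilityMeasure_map measurable_reports.aemeasurable
  have := hp w
  have := hp w'
  exact measureReal_le_add_of_isSetAlgebra isSetAlgebra_measurableCylinders
    generateFrom_measurableCylinders.symm
    (fun t ht => G.measureReal_reports_cylinder_le lam σ h w w' ht) ht

theorem Game.value_eq (G : Game A M Ω R P) (lam : unitInterval) (σ : List M → Plan A M)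
    {i : ℕ} (hi : G.NonEthical i) (ω : Ω) (h : List M) (w : Ω × Stream'.Seq A) :
    G.value lam σ i h w = ∫ x, G.V i (reports x) ω ∂(G.pathLaw lam σ (h, w)) := by
  unfold Game.value
  exact integral_congr_ae (Filter.Eventually.of_forall fun x => hi _ _ _)

theorem Game.measurable_V (G : Game A M Ω R P) (i : ℕ) (ω : Ω) :
    Measurable (fun x => G.V i x ω) :=
  (G.V_measurable i).comp (measurable_id.prodMk measurable_const)

theorem Game.nonempty_prod (G : Game A M Ω R P) : Nonempty (Ω × Stream'.Seq A) :=
  nonempty_of_isProbabilityMeasure G.prior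

theorem Game.neg_le (G : Game A M Ω R P) : -P ≤ R := by
  obtain ⟨w⟩ := G.nonempty_prod
  exact (G.V_mem 0 (fun _ => Classical.arbitrary M) w.1).1.trans
    (G.V_mem 0 (fun _ => Classical.arbitrary M) w.1).2

theorem Game.measurable_value (G : Game A M Ω R P) (lam : unitInterval) (σ : List M → Plan A M)
    {i : ℕ} (hi : G.NonEthical i) (h : List M) : Measurable (G.value lam σ i h) := by
  obtain ⟨w₀⟩ := G.nonempty_prod
  have h1 : Measurable (fun w : Ω × Stream'.Seq A =>
      (fun _ => (h, w) : Finset.Iic 0 → State A M Ω)) :=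
    measurable_pi_lambda _ fun _ => measurable_const.prodMk measurable_id
  set κ : (n : ℕ) → Kernel (Π _ : Finset.Iic n, State A M Ω) (State A M Ω) := fun n =>
    (G.stepKernel lam σ).comap (fun y => y ⟨n, Finset.mem_Iic.2 le_rfl⟩) (measurable_pi_apply _)
  have h2 : StronglyMeasurable (fun x => ∫ y, G.V i (reports y) w₀.1
      ∂(Kernel.traj (X := fun _ => State A M Ω) κ 0 x)) :=
    StronglyMeasurable.integral_kernel (κ := Kernel.traj (X := fun _ => State A M Ω) κ 0)
      ((G.measurable_V i w₀.1).comp measurable_reports).stronglyMeasurable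
  have h3 : G.value lam σ i h = fun w => ∫ y, G.V i (reports y) w₀.1
      ∂(Kernel.traj (X := fun _ => State A M Ω) κ 0 (fun _ => (h, w))) := by
    funext w
    exact G.value_eq lam σ hi w₀.1 h w
  rw [h3]
  exact h2.measurable.comp h1

theorem Game.value_mem (G : Game A M Ω R P) (lam : unitInterval) (σ : List M → Plan A M)
    {i : ℕ} (hi : G.NonEthical i) (h : List M) (w : Ω × Stream'.Seq A) :
    G.value lam σ i h w ∈ Set.Icc (-P) R := by
  rw [G.value_eq lam σ hi w.1]
  have hint : Integrable (fun x => G.V i (reports x) w.1) (G.pathLaw lam σ (h, w)) :=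
    integrable_of_mem_Icc ((G.measurable_V i w.1).comp measurable_reports)
      (fun x => G.V_mem i _ _)
  constructor
  · have := integral_mono (integrable_const (-P)) hint (fun x => (G.V_mem i (reports x) w.1).1)
    simpa using this
  · have := integral_mono hint (integrable_const R) (fun x => (G.V_mem i (reports x) w.1).2)
    simpa using this

/-- The continuation value depends on the fact and on the remaining signals at most in proportion
to the probability of a later favourable coin. -/
theorem Game.value_le_add (G : Game A M Ω R P) (lam : unitInterval) (σ : List M → Plan A M)
    {i : ℕ} (hi : G.NonEthical i) (h : List M) (w w' : Ω × Stream'.Seq A) :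
    G.value lam σ i h w ≤ G.value lam σ i h w' + (R + P) * peril lam σ h := by
  have hp : ∀ v, IsProbabilityMeasure ((G.pathLaw lam σ (h, v)).map reports) := fun v =>
    Measure.isProbabilityMeasure_map measurable_reports.aemeasurable
  have := hp w
  have := hp w'
  have h1 := integral_le_add_of_measureReal_le_add
    (fun s hs => G.measureReal_reports_le lam σ h w w' hs) (G.measurable_V i w.1) G.neg_le
    (fun x => G.V_mem i x w.1)
  have hmap : ∀ v, ∫ x, G.V i x w.1 ∂((G.pathLaw lam σ (h, v)).map reports) =
      G.value lam σ i h v := fun v => by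
    rw [G.value_eq lam σ hi w.1, integral_map measurable_reports.aemeasurable
      (G.measurable_V i w.1).aestronglyMeasurable]
  rw [hmap, hmap] at h1
  linarith

end

/-! ### Incentives of an agent who works -/

section

variable {A M Ω : Type*} [Fintype M] [MeasurableSpace M] [MeasurableSpace Ω] {R P : ℝ}

theorem integral_mix {X : Type*} [MeasurableSpace X] (t : unitInterval) {μ ν : Measure X}
    {f : X → ℝ} (hμ : Integrable f μ) (hν : Integrable f ν) :
    ∫ x, f x ∂(mix t μ ν) = t * ∫ x, f x ∂μ + (1 - t) * ∫ x, f x ∂ν := by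
  rw [mix, integral_add_measure (hμ.smul_measure ENNReal.ofReal_ne_top)
    (hν.smul_measure ENNReal.ofReal_ne_top), integral_smul_measure, integral_smul_measure,
    ENNReal.toReal_ofReal t.2.1, ENNReal.toReal_ofReal (sub_nonneg.2 t.2.2), smul_eq_mul,
    smul_eq_mul]

theorem sum_report_toReal (r : Obs A → PMF M) (o : Obs A) : ∑ m : M, (r o m).toReal = 1 := by
  have h := sum_report (⟨0, r⟩ : Plan A M) o
  rw [← ENNReal.toReal_sum fun m _ => (r o).apply_ne_top m]
  exact (congrArg ENNReal.toReal h).trans ENNReal.toReal_one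

theorem Game.ae_success_ne_shirk (G : Game A M Ω R P) (i : ℕ) (μ : Measure (Ω × Stream'.Seq A)) :
    ∀ᵐ y ∂(μ.bind (G.success i)), y.1 ≠ Obs.shirk := by
  have hS : MeasurableSet {y : Obs A × (Ω × Stream'.Seq A) | ¬ y.1 ≠ Obs.shirk} :=
    measurable_fst (MeasurableSpace.measurableSet_top : MeasurableSet[⊤] {o : Obs A | ¬ o ≠ .shirk})
  rw [ae_iff, Measure.bind_apply hS (G.measurable_success i).aemeasurable]
  refine (lintegral_eq_zero_iff ((Measure.measurable_coe hS).comp (G.measurable_success i))).2 ?_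
  refine Filter.Eventually.of_forall fun w => ?_
  change G.success i w {y | ¬ y.1 ≠ Obs.shirk} = 0
  unfold Game.success
  split_ifs
  · rw [Measure.dirac_apply' _ hS]
    simp
  · rw [Measure.map_apply measurable_from_top hS]
    convert measure_empty (μ := G.pick i w.2)
    ext n
    simp only [Set.mem_preimage, Set.mem_ofPred_eq, not_not, Set.mem_empty_iff_false, iff_false]
    unfold discovery
    split <;> simp

variable [Nonempty M]

/-- Expected gross utility of the agent who moves at the history `h` if he has observed `y.1`, the
fact and the remaining signals are `y.2`, and he reports according to `r`. -/
def Game.gain (G : Game A M Ω R P) (lam : unitInterval) (σ : List M → Plan A M) (h : List M)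
    (r : Obs A → PMF M) (y : Obs A × (Ω × Stream'.Seq A)) : ℝ :=
  ∑ m : M, (r y.1 m).toReal * G.value lam σ h.length (h ++ [m]) y.2

section

variable {G : Game A M Ω R P} {c : ℝ} {lam : unitInterval} {σ : List M → Plan A M}

theorem Game.measurable_gain (hne : ∀ i, G.NonEthical i) (h : List M) (r : Obs A → PMF M) :
    Measurable (G.gain lam σ h r) := by
  refine Finset.measurable_sum _ fun m _ => Measurable.mul ?_ ?_
  · exact (measurable_obs_fun (fun o : Obs A => (r o m).toReal)).comp measurable_fst
  · exact (G.measurable_value lam σ (hne _) _).comp measurable_snd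

theorem Game.gain_mem (hne : ∀ i, G.NonEthical i) (h : List M) (r : Obs A → PMF M)
    (y : Obs A × (Ω × Stream'.Seq A)) : G.gain lam σ h r y ∈ Set.Icc (-P) R := by
  have h1 := sum_report_toReal r y.1
  unfold Game.gain
  constructor
  · calc -P = ∑ m : M, (r y.1 m).toReal * (-P) := by rw [← Finset.sum_mul, h1, one_mul]
      _ ≤ _ := Finset.sum_le_sum fun m _ =>
        mul_le_mul_of_nonneg_left (G.value_mem lam σ (hne _) _ _).1 ENNReal.toReal_nonneg
  · calc _ ≤ ∑ m : M, (r y.1 m).toReal * R := Finset.sum_le_sum fun m _ =>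
        mul_le_mul_of_nonneg_left (G.value_mem lam σ (hne _) _ _).2 ENNReal.toReal_nonneg
      _ = R := by rw [← Finset.sum_mul, h1, one_mul]

theorem Game.integrable_gain (hne : ∀ i, G.NonEthical i) (h : List M) (r : Obs A → PMF M)
    (ρ : Measure (Obs A × (Ω × Stream'.Seq A))) [IsFiniteMeasure ρ] :
    Integrable (G.gain lam σ h r) ρ :=
  integrable_of_mem_Icc (G.measurable_gain hne h r) (G.gain_mem hne h r)

theorem Game.planPayoff_eq (hne : ∀ i, G.NonEthical i) (hc : 0 < c) (h : List M)
    (μ : Measure (Ω × Stream'.Seq A)) [IsProbabilityMeasure μ] (p : Plan A M) :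
    G.planPayoff c lam σ h μ p =
      p.work * (lam * ∫ y, G.gain lam σ h p.report y ∂(μ.bind (G.success h.length)) +
        (1 - lam) * ∫ w, G.gain lam σ h p.report (Obs.nothing, w) ∂μ - c) +
      (1 - p.work) * ∫ w, G.gain lam σ h p.report (Obs.shirk, w) ∂μ := by
  have heff : Measurable (fun y : Obs A × (Ω × Stream'.Seq A) => effort c y.1) :=
    (measurable_obs_fun (effort c)).comp measurable_fst
  have heffb : ∀ y : Obs A × (Ω × Stream'.Seq A), effort c y.1 ∈ Set.Icc 0 c := by
    rintro ⟨_ | _ | _, w⟩ <;> simp [effort, hc.le]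
  have hg := G.integrable_gain (lam := lam) (σ := σ) hne h p.report
  have hi : ∀ ρ : Measure (Obs A × (Ω × Stream'.Seq A)), IsProbabilityMeasure ρ →
      Integrable (fun y => G.gain lam σ h p.report y - effort c y.1) ρ := fun ρ _ =>
    (hg ρ).sub (integrable_of_mem_Icc heff heffb)
  have htag : ∀ o : Obs A, IsProbabilityMeasure (μ.map (fun w => (o, w))) := fun o =>
    Measure.isProbabilityMeasure_map (measurable_tag o).aemeasurable
  have h1 := htag Obs.nothing
  have h2 := htag Obs.shirk
  have h3 := mix_prob lam (μ.bind (G.success h.length)) (μ.map (fun w => (Obs.nothing, w)))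
  have hmap : ∀ o : Obs A, ∫ y, (G.gain lam σ h p.report y - effort c y.1)
      ∂(μ.map (fun w => (o, w))) = ∫ w, G.gain lam σ h p.report (o, w) ∂μ - effort c o := by
    intro o
    have hd : Measurable (fun y : Obs A × (Ω × Stream'.Seq A) =>
        G.gain lam σ h p.report y - effort c y.1) := (G.measurable_gain hne h p.report).sub heff
    rw [integral_map (measurable_tag o).aemeasurable hd.aestronglyMeasurable]
    change ∫ w, (G.gain lam σ h p.report (o, w) - effort c o) ∂μ = _
    rw [integral_sub _ (integrable_const _)]
    · simp
    · exact integrable_of_mem_Icc ((G.measurable_gain hne h p.report).comp (measurable_tag o))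
        (fun w => G.gain_mem hne h p.report (o, w))
  have hsucc : ∫ y, (G.gain lam σ h p.report y - effort c y.1) ∂(μ.bind (G.success h.length)) =
      ∫ y, G.gain lam σ h p.report y ∂(μ.bind (G.success h.length)) - c := by
    have : ∫ y, (G.gain lam σ h p.report y - effort c y.1) ∂(μ.bind (G.success h.length)) =
        ∫ y, (G.gain lam σ h p.report y - c) ∂(μ.bind (G.success h.length)) := by
      refine integral_congr_ae ?_
      filter_upwards [G.ae_success_ne_shirk h.length μ] with y hy
      obtain ⟨_ | _ | _, w⟩ := y
      · exact absurd rfl hy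
      · rfl
      · rfl
    rw [this, integral_sub (hg _) (integrable_const _)]
    simp
  have hdef : G.planPayoff c lam σ h μ p = ∫ y, (G.gain lam σ h p.report y - effort c y.1)
      ∂(μ.bind (G.explore lam h.length p.work)) := rfl
  rw [hdef, G.bind_explore, integral_mix _ (hi _ h3) (hi _ h2),
    integral_mix _ (hi _ inferInstance) (hi _ h1), hmap, hmap, hsucc]
  simp only [effort]
  ring

end

variable {G : Game A M Ω R P} {c : ℝ} {lam : unitInterval} {a : Assessment A M Ω}

/-- The expected gross utility of an agent who works at the history `h` and has a favourable
coin. -/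
def Game.luckyGain (G : Game A M Ω R P) (lam : unitInterval) (a : Assessment A M Ω)
    (h : List M) : ℝ :=
  ∫ y, G.gain lam a.strategy h (a.strategy h).report y
    ∂((a.belief h).bind (G.success h.length))

/-- The probability that an agent who works at the history `h` and has a favourable coin sends
the report `m`. -/
def Game.luckyReport (G : Game A M Ω R P) (a : Assessment A M Ω) (h : List M) (m : M) : ℝ :=
  (G.echo a.strategy h m (a.belief h)).real Set.univ

theorem Game.luckyReport_nonneg (h : List M) (m : M) : 0 ≤ G.luckyReport a h m :=
  measureReal_nonneg

theorem Game.luckyReport_eq_integral (h : List M) (m : M) : G.luckyReport a h m =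
    ∫ y, ((a.strategy h).report y.1 m).toReal ∂((a.belief h).bind (G.success h.length)) := by
  rw [Game.luckyReport, measureReal_def, G.echo_univ, integral_toReal]
  · exact (measurable_report (a.strategy h) m).aemeasurable
  · exact Filter.Eventually.of_forall fun y => (PMF.apply_lt_top _ _)

theorem integrable_report (h : List M) (m : M) :
    Integrable (fun y : Obs A × (Ω × Stream'.Seq A) => ((a.strategy h).report y.1 m).toReal)
      ((a.belief h).bind (G.success h.length)) :=
  integrable_of_mem_Icc (lo := 0) (hi := 1) (measurable_report (a.strategy h) m).ennreal_toReal
    fun y => ⟨ENNReal.toReal_nonneg, by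
      simpa using ENNReal.toReal_mono ENNReal.one_ne_top (PMF.coe_le_one _ m)⟩

theorem Game.sum_luckyReport (h : List M) : ∑ m : M, G.luckyReport a h m = 1 := by
  simp only [G.luckyReport_eq_integral]
  rw [← integral_finsetSum _ fun m _ => integrable_report h m]
  simp [sum_report_toReal]

/-- Working and reporting whatever the strategy prescribes beats every report without work. -/
theorem Game.IsWeakPBE.shirk_le (ha : G.IsWeakPBE c lam a) (hne : ∀ i, G.NonEthical i)
    (hc : 0 < c) {h : List M} (hg : 0 < (a.strategy h).work) (q : Obs A → PMF M) :
    ∫ w, G.gain lam a.strategy h q (Obs.shirk, w) ∂(a.belief h) ≤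
      lam * G.luckyGain lam a h + (1 - lam) *
        ∫ w, G.gain lam a.strategy h (a.strategy h).report (Obs.nothing, w) ∂(a.belief h) - c := by
  have hg' : (0 : ℝ) < (a.strategy h).work := hg
  have hg1 : ((a.strategy h).work : ℝ) ≤ 1 := (a.strategy h).work.2.2
  set X := (lam : ℝ) * G.luckyGain lam a h + (1 - lam) *
      ∫ w, G.gain lam a.strategy h (a.strategy h).report (Obs.nothing, w) ∂(a.belief h) - c with hX
  have key : ∀ q : Obs A → PMF M,
      ∫ w, G.gain lam a.strategy h q (Obs.shirk, w) ∂(a.belief h) ≤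
        (a.strategy h).work * X + (1 - (a.strategy h).work) *
          ∫ w, G.gain lam a.strategy h (a.strategy h).report (Obs.shirk, w) ∂(a.belief h) := by
    intro q
    have := ha.rational h ⟨0, q⟩
    rw [G.planPayoff_eq hne hc, G.planPayoff_eq hne hc] at this
    simpa [hX, Game.luckyGain] using this
  have h1 := key (a.strategy h).report
  have h2 := key q
  set Y := ∫ w, G.gain lam a.strategy h (a.strategy h).report (Obs.shirk, w) ∂(a.belief h)
  have h3 : Y ≤ X := by
    by_contra hlt
    push Not at hlt
    nlinarith
  nlinarith

theorem Game.IsWeakPBE.unlucky_add_le (ha : G.IsWeakPBE c lam a) (hne : ∀ i, G.NonEthical i)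
    (hc : 0 < c) {h : List M} (hg : 0 < (a.strategy h).work) :
    ∫ w, G.gain lam a.strategy h (a.strategy h).report (Obs.nothing, w) ∂(a.belief h) + c ≤
      G.luckyGain lam a h := by
  have h1 := ha.shirk_le hne hc hg (fun _ => (a.strategy h).report Obs.nothing)
  have h2 : ∀ w, G.gain lam a.strategy h (fun _ => (a.strategy h).report Obs.nothing)
      (Obs.shirk, w) = G.gain lam a.strategy h (a.strategy h).report (Obs.nothing, w) :=
    fun w => rfl
  simp only [h2] at h1
  have h3 : (0 : ℝ) ≤ lam := lam.2.1
  have h4 : (lam : ℝ) ≤ 1 := lam.2.2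
  set X := G.luckyGain lam a h
  set Y := ∫ w, G.gain lam a.strategy h (a.strategy h).report (Obs.nothing, w) ∂(a.belief h)
  have h5 : c ≤ lam * (X - Y) := by linarith
  have h6 : 0 ≤ X - Y := by
    by_contra hlt
    push Not at hlt
    linarith [mul_nonpos_of_nonneg_of_nonpos h3 hlt.le]
  linarith [mul_le_of_le_one_left h6 h4]

theorem Game.IsWeakPBE.shirk_add_le (ha : G.IsWeakPBE c lam a) (hne : ∀ i, G.NonEthical i)
    (hc : 0 < c) {h : List M} (hg : 0 < (a.strategy h).work) (m : M) :
    ∫ w, G.value lam a.strategy h.length (h ++ [m]) w ∂(a.belief h) + c ≤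
      G.luckyGain lam a h := by
  classical
  have h1 := ha.shirk_le hne hc hg (fun _ => PMF.pure m)
  have h2 : ∀ w, G.gain lam a.strategy h (fun _ => PMF.pure m) (Obs.shirk, w) =
      G.value lam a.strategy h.length (h ++ [m]) w := by
    intro w
    unfold Game.gain
    rw [Finset.sum_eq_single m]
    · simp
    · intro b _ hb
      simp [PMF.pure_apply, hb]
    · simp
  simp only [h2] at h1
  have h0 := ha.unlucky_add_le hne hc hg
  have h4 : (lam : ℝ) ≤ 1 := lam.2.2
  nlinarith

/-- An agent works only if he believes that some signal is left with probability bounded below. -/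
theorem Game.IsWeakPBE.le_moreThan_zero (ha : G.IsWeakPBE c lam a) (hne : ∀ i, G.NonEthical i)
    (hc : 0 < c) {h : List M} (hg : 0 < (a.strategy h).work) :
    c ≤ (R + P) * (a.belief h).real (moreThan A Ω 0) := by
  have h0 := ha.unlucky_add_le hne hc hg
  have hp : IsProbabilityMeasure ((a.belief h).map (fun w => (Obs.nothing (A := A), w))) :=
    Measure.isProbabilityMeasure_map (measurable_tag _).aemeasurable
  have h1 : ∀ s, MeasurableSet s → ((a.belief h).bind (G.success h.length)).real s ≤
      ((a.belief h).map (fun w => (Obs.nothing (A := A), w))).real s +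
        (a.belief h).real (moreThan A Ω 0) := by
    intro s hs
    have hle : (a.belief h).bind (G.success h.length) s ≤
        (a.belief h).map (fun w => (Obs.nothing (A := A), w)) s +
          (a.belief h) (moreThan A Ω 0) := by
      rw [Measure.bind_apply hs (G.measurable_success _).aemeasurable,
        ← lintegral_indicator_one (measurableSet_moreThan 0), ← lintegral_indicator_one hs,
        lintegral_map (measurable_one.indicator hs) (measurable_tag _),
        ← lintegral_add_right _ (measurable_one.indicator (measurableSet_moreThan 0))]
      refine lintegral_mono fun w => ?_
      by_cases hw : w ∈ moreThan A Ω 0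
      · rw [Set.indicator_of_mem hw]
        exact prob_le_one.trans le_add_self
      · have hnil : w.2 = Stream'.Seq.nil := by
          have h0 : w.2.get? 0 = none := by simpa [moreThan] using hw
          ext1 n
          rw [Stream'.Seq.get?_nil]
          exact Stream'.Seq.le_stable _ (Nat.zero_le n) h0
        rw [Game.success, if_pos hnil, Measure.dirac_apply' _ hs]
        exact le_self_add
    have := ENNReal.toReal_mono (by finiteness) hle
    rwa [ENNReal.toReal_add (by finiteness) (by finiteness)] at this
  have h2 := integral_le_add_of_measureReal_le_add h1
    (G.measurable_gain (lam := lam) (σ := a.strategy) hne h (a.strategy h).report) G.neg_le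
    (G.gain_mem hne h (a.strategy h).report)
  rw [integral_map (measurable_tag _).aemeasurable
    (G.measurable_gain hne h (a.strategy h).report).aestronglyMeasurable] at h2
  unfold Game.luckyGain at h0
  linarith

theorem Game.gain_eq_add_sum_sub (h : List M) (r : Obs A → PMF M) (u : ℝ)
    (y : Obs A × (Ω × Stream'.Seq A)) :
    G.gain lam a.strategy h r y = u + ∑ m : M, (r y.1 m).toReal *
      (G.value lam a.strategy h.length (h ++ [m]) y.2 - u) := by
  unfold Game.gain
  simp only [mul_sub, Finset.sum_sub_distrib]
  rw [← Finset.sum_mul, sum_report_toReal]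
  ring

/-- After a favourable coin, an agent who works sends with probability bounded below a report that
leaves some probability of later favourable coins. Otherwise the best of the other reports, whose
value does not depend on the remaining signals, would be better than working. -/
theorem Game.IsWeakPBE.le_sum_luckyReport (ha : G.IsWeakPBE c lam a)
    (hne : ∀ i, G.NonEthical i) (hc : 0 < c) {h : List M} (hg : 0 < (a.strategy h).work)
    (s : Finset M) (hs : ∀ m, m ∉ s → peril lam a.strategy (h ++ [m]) ≤ 0) :
    c ≤ (R + P) * ∑ m ∈ s, G.luckyReport a h m := by
  classical
  obtain ⟨w₀⟩ := G.nonempty_prod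
  set v : M → (Ω × Stream'.Seq A) → ℝ := fun m w =>
    G.value lam a.strategy h.length (h ++ [m]) w with hv
  have hRP : 0 ≤ R + P := by linarith [G.neg_le]
  have hvi : ∀ m, Integrable (v m) (a.belief h) := fun m =>
    integrable_of_mem_Icc (G.measurable_value lam a.strategy (hne _) _)
      (G.value_mem lam a.strategy (hne _) _)
  rcases (Finset.univ \ s).eq_empty_or_nonempty with hemp | hnemp
  · have hsu : s = Finset.univ :=
      Finset.eq_univ_of_forall fun m => by
        by_contra hm
        exact Finset.notMem_empty m (hemp ▸ Finset.mem_sdiff.2 ⟨Finset.mem_univ m, hm⟩)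
    rw [hsu, G.sum_luckyReport, mul_one]
    have h1 := ha.shirk_add_le hne hc hg (Classical.arbitrary M)
    have h2 : G.luckyGain lam a h ≤ R := by
      have := integral_mono (G.integrable_gain hne h (a.strategy h).report
        ((a.belief h).bind (G.success h.length))) (integrable_const R)
        (fun y => (G.gain_mem (lam := lam) (σ := a.strategy) hne h (a.strategy h).report y).2)
      simpa [Game.luckyGain] using this
    have h3 : -P ≤ ∫ w, v (Classical.arbitrary M) w ∂(a.belief h) := by
      have := integral_mono (integrable_const (-P)) (hvi (Classical.arbitrary M))
        (fun w => (G.value_mem lam a.strategy (hne _) _ w).1)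
      simpa using this
    simp only [hv] at h3
    linarith
  · obtain ⟨m₀, hm₀, hmax⟩ := Finset.exists_max_image _ (fun m => v m w₀) hnemp
    have hm₀' : m₀ ∉ s := (Finset.mem_sdiff.1 hm₀).2
    have hconst : ∀ m, m ∉ s → ∀ w w', v m w ≤ v m w' := by
      intro m hm w w'
      have h1 := G.value_le_add lam a.strategy (hne h.length) (h ++ [m]) w w'
      have h2 : peril lam a.strategy (h ++ [m]) = 0 :=
        le_antisymm (hs m hm) (peril_nonneg _ _ _)
      rw [h2, mul_zero, add_zero] at h1
      exact h1
    have h1 := ha.shirk_add_le hne hc hg m₀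
    have h2 : v m₀ w₀ ≤ ∫ w, v m₀ w ∂(a.belief h) := by
      have := integral_mono (integrable_const (v m₀ w₀)) (hvi m₀)
        (fun w => hconst m₀ hm₀' w₀ w)
      simpa using this
    have hr := fun m => integrable_report (G := G) (a := a) h m
    have h3 : G.luckyGain lam a h ≤ v m₀ w₀ + (R + P) * ∑ m ∈ s, G.luckyReport a h m := by
      have hpt : ∀ y : Obs A × (Ω × Stream'.Seq A),
          G.gain lam a.strategy h (a.strategy h).report y ≤
          v m₀ w₀ + (R + P) * ∑ m ∈ s, ((a.strategy h).report y.1 m).toReal := by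
        intro y
        rw [G.gain_eq_add_sum_sub h _ (v m₀ w₀) y, ← Finset.sum_sdiff (Finset.subset_univ s),
          Finset.mul_sum]
        have e1 : ∑ m ∈ Finset.univ \ s, ((a.strategy h).report y.1 m).toReal *
            (v m y.2 - v m₀ w₀) ≤ 0 := by
          refine Finset.sum_nonpos fun m hm => mul_nonpos_of_nonneg_of_nonpos
            ENNReal.toReal_nonneg ?_
          have := hconst m (Finset.mem_sdiff.1 hm).2 y.2 w₀
          linarith [hmax m hm]
        have e2 : ∑ m ∈ s, ((a.strategy h).report y.1 m).toReal * (v m y.2 - v m₀ w₀) ≤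
            ∑ m ∈ s, (R + P) * ((a.strategy h).report y.1 m).toReal := by
          refine Finset.sum_le_sum fun m _ => ?_
          rw [mul_comm]
          refine mul_le_mul_of_nonneg_right ?_ ENNReal.toReal_nonneg
          have e3 := (G.value_mem lam a.strategy (hne h.length) (h ++ [m]) y.2).2
          have e4 := (G.value_mem lam a.strategy (hne h.length) (h ++ [m₀]) w₀).1
          simp only [hv]
          linarith
        linarith
      have hint := integral_mono (G.integrable_gain hne h (a.strategy h).report
        ((a.belief h).bind (G.success h.length)))
        ((integrable_const (v m₀ w₀)).add ((integrable_finsetSum s fun m _ => hr m).const_mul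
          (R + P))) hpt
      simp only [Pi.add_apply] at hint
      rw [integral_add (integrable_const _)
        ((integrable_finsetSum s fun m _ => hr m).const_mul (R + P)), integral_const_mul,
        integral_finsetSum _ fun m _ => hr m] at hint
      simp only [G.luckyReport_eq_integral]
      simpa [Game.luckyGain] using hint
    linarith

/-- An agent works only if the reports that he sends after a favourable coin carry, on average, a
probability of later favourable coins that is bounded below. -/
theorem Game.IsWeakPBE.le_sum_luckyReport_mul_peril (ha : G.IsWeakPBE c lam a)
    (hne : ∀ i, G.NonEthical i) (hc : 0 < c) {h : List M} (hg : 0 < (a.strategy h).work) :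
    c ≤ 2 * (R + P) * ∑ m : M, G.luckyReport a h m * peril lam a.strategy (h ++ [m]) := by
  obtain ⟨w₀⟩ := G.nonempty_prod
  set v : M → (Ω × Stream'.Seq A) → ℝ := fun m w =>
    G.value lam a.strategy h.length (h ++ [m]) w with hv
  have hvi : ∀ m, Integrable (v m) (a.belief h) := fun m =>
    integrable_of_mem_Icc (G.measurable_value lam a.strategy (hne _) _)
      (G.value_mem lam a.strategy (hne _) _)
  have hval := fun m w w' => G.value_le_add lam a.strategy (hne h.length) (h ++ [m]) w w'
  set p : M → ℝ := fun m => peril lam a.strategy (h ++ [m]) with hp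
  have h1 : ∀ m, v m w₀ - (R + P) * p m + c ≤ G.luckyGain lam a h := by
    intro m
    have e1 := ha.shirk_add_le hne hc hg m
    have e2 := integral_mono (integrable_const (v m w₀ - (R + P) * p m)) (hvi m)
      (fun w => by have := hval m w₀ w; simp only [hv, hp]; linarith)
    simp only [integral_const, probReal_univ, one_smul] at e2
    simp only [hv] at e2 ⊢
    linarith
  have hr := fun m => integrable_report (G := G) (a := a) h m
  have h2 : G.luckyGain lam a h ≤
      ∑ m : M, G.luckyReport a h m * (v m w₀ + (R + P) * p m) := by
    have hint := integral_mono (G.integrable_gain (lam := lam) (σ := a.strategy) hne h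
      (a.strategy h).report ((a.belief h).bind (G.success h.length)))
      (integrable_finsetSum Finset.univ fun m _ => (hr m).mul_const (v m w₀ + (R + P) * p m))
      (fun y => Finset.sum_le_sum fun m _ => mul_le_mul_of_nonneg_left (hval m y.2 w₀)
        ENNReal.toReal_nonneg)
    rw [integral_finsetSum _ fun m _ => (hr m).mul_const _] at hint
    simp only [integral_mul_const, ← G.luckyReport_eq_integral] at hint
    exact hint
  have h3 : ∑ m : M, G.luckyReport a h m * (v m w₀ - (R + P) * p m + c) ≤
      ∑ m : M, G.luckyReport a h m * G.luckyGain lam a h :=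
    Finset.sum_le_sum fun m _ => mul_le_mul_of_nonneg_left (h1 m) (G.luckyReport_nonneg h m)
  rw [← Finset.sum_mul, G.sum_luckyReport, one_mul] at h3
  have h4 : ∑ m : M, G.luckyReport a h m * (v m w₀ - (R + P) * p m + c) =
      ∑ m : M, G.luckyReport a h m * (v m w₀ + (R + P) * p m) -
        2 * (R + P) * ∑ m : M, G.luckyReport a h m * p m + c := by
    have : ∀ m, G.luckyReport a h m * (v m w₀ - (R + P) * p m + c) =
        G.luckyReport a h m * (v m w₀ + (R + P) * p m) -
          2 * (R + P) * (G.luckyReport a h m * p m) + G.luckyReport a h m * c := fun m => by ring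
    simp only [this, Finset.sum_add_distrib, Finset.sum_sub_distrib, ← Finset.mul_sum,
      ← Finset.sum_mul, G.sum_luckyReport, one_mul]
  linarith

end

/-! ### Masses at the nodes of the tree of reports -/

section

variable {A M Ω : Type*} [Fintype M] [MeasurableSpace M] [MeasurableSpace Ω] {R P : ℝ}

/-- The operation that takes the measure at the node `h` to the measure at `h ++ [m]`, as an
operation on arbitrary measures. -/
def Game.push (G : Game A M Ω R P) (lam : unitInterval) (σ : List M → Plan A M) (h : List M)
    (m : M) (ν : Measure (Ω × Stream'.Seq A)) : Measure (Ω × Stream'.Seq A) :=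
  quiet lam σ h m • ν + (ENNReal.ofReal (σ h).work * ENNReal.ofReal lam) • G.echo σ h m ν

section

variable {G : Game A M Ω R P} {lam : unitInterval} {σ : List M → Plan A M} {h : List M}

theorem Game.node_append_eq_push (m : M) :
    G.node lam σ (h ++ [m]) = G.push lam σ h m (G.node lam σ h) := G.node_append lam σ h m

theorem Game.push_add (m : M) (ν ν' : Measure (Ω × Stream'.Seq A)) :
    G.push lam σ h m (ν + ν') = G.push lam σ h m ν + G.push lam σ h m ν' := by
  unfold Game.push
  rw [G.echo_add, smul_add, smul_add]
  abel

theorem Game.echo_univ_le (m : M) (ν : Measure (Ω × Stream'.Seq A)) :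
    G.echo σ h m ν Set.univ ≤ ν Set.univ := by
  rw [← G.sum_echo_univ σ h ν]
  exact Finset.single_le_sum (f := fun m => G.echo σ h m ν Set.univ) (fun _ _ => zero_le)
    (Finset.mem_univ m)

instance (m : M) (ν : Measure (Ω × Stream'.Seq A)) [IsFiniteMeasure ν] :
    IsFiniteMeasure (G.echo σ h m ν) :=
  ⟨(G.echo_univ_le m ν).trans_lt (measure_lt_top _ _)⟩

theorem Game.push_real (m : M) (ν : Measure (Ω × Stream'.Seq A)) [IsFiniteMeasure ν]
    (s : Set (Ω × Stream'.Seq A)) :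
    (G.push lam σ h m ν).real s = (quiet lam σ h m).toReal * ν.real s +
      (σ h).work * lam * (G.echo σ h m ν).real s := by
  have h1 := quiet_ne_top lam σ h m
  simp only [Game.push, measureReal_def, Measure.coe_add, Measure.coe_smul, Pi.add_apply,
    Pi.smul_apply, smul_eq_mul]
  rw [ENNReal.toReal_add (by finiteness) (by finiteness)]
  simp only [ENNReal.toReal_mul]
  rw [ENNReal.toReal_ofReal (σ h).work.2.1, ENNReal.toReal_ofReal lam.2.1]

instance (m : M) (ν : Measure (Ω × Stream'.Seq A)) [IsFiniteMeasure ν] :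
    IsFiniteMeasure (G.push lam σ h m ν) := by
  have h1 := quiet_ne_top lam σ h m
  constructor
  simp only [Game.push, Measure.coe_add, Measure.coe_smul, Pi.add_apply,
    Pi.smul_apply, smul_eq_mul]
  finiteness

theorem Game.sum_echo_real (ν : Measure (Ω × Stream'.Seq A)) [IsFiniteMeasure ν] :
    ∑ m : M, (G.echo σ h m ν).real Set.univ = ν.real Set.univ := by
  simp only [measureReal_def]
  rw [← ENNReal.toReal_sum fun m _ => measure_ne_top _ _, G.sum_echo_univ]

theorem Game.sum_push_real (ν : Measure (Ω × Stream'.Seq A)) [IsFiniteMeasure ν] :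
    ∑ m : M, (G.push lam σ h m ν).real Set.univ = ν.real Set.univ := by
  simp only [G.push_real]
  rw [Finset.sum_add_distrib, ← Finset.sum_mul, ← Finset.mul_sum, G.sum_echo_real, ← add_mul,
    sum_quiet_toReal, one_mul]

theorem Game.push_moreThan_succ (m : M) {ν : Measure (Ω × Stream'.Seq A)} {j : ℕ}
    (hν : ν (moreThan A Ω (j + 1)) = 0) :
    G.push lam σ h m ν (moreThan A Ω (j + 1)) = 0 := by
  have h1 : G.echo σ h m ν (moreThan A Ω (j + 1)) = 0 :=
    measure_mono_null (moreThan_succ_subset j) (G.echo_moreThan σ h m ν j hν)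
  simp [Game.push, hν, h1]

/-- Where at most `j + 1` signals are left, a history keeps all of them only if no coin has been
favourable. -/
theorem Game.push_moreThan (m : M) {ν : Measure (Ω × Stream'.Seq A)} [IsFiniteMeasure ν] {j : ℕ}
    (hν : ν (moreThan A Ω (j + 1)) = 0) :
    (G.push lam σ h m ν).real (moreThan A Ω j) =
      (quiet lam σ h m).toReal * ν.real (moreThan A Ω j) := by
  rw [G.push_real, measureReal_def (G.echo σ h m ν), G.echo_moreThan σ h m ν j hν]
  simp

/-- The probability of reaching the history `h`. -/
def Game.mass (G : Game A M Ω R P) (lam : unitInterval) (σ : List M → Plan A M) (h : List M) : ℝ :=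
  (G.node lam σ h).real Set.univ

/-- The probability of reaching the history `h` with more than `j` signals left. -/
def Game.massMore (G : Game A M Ω R P) (lam : unitInterval) (σ : List M → Plan A M) (j : ℕ)
    (h : List M) : ℝ :=
  (G.node lam σ h).real (moreThan A Ω j)

theorem Game.massMore_le_mass (j : ℕ) : G.massMore lam σ j h ≤ G.mass lam σ h :=
  measureReal_mono (Set.subset_univ _)

theorem Game.mass_nonneg : 0 ≤ G.mass lam σ h := measureReal_nonneg

theorem Game.onPath_of_mass_pos (hm : 0 < G.mass lam σ h) : G.OnPath lam σ h := by
  rw [G.onPath_iff]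
  intro h0
  rw [Game.mass, measureReal_def, h0] at hm
  simp at hm

/-- A history after which later favourable coins are possible leads, without any work in between,
to a history at which the agent works with positive probability. The belief stays the same. -/
theorem Game.exists_work_pos {n : ℕ} (hm : 0 < G.mass lam σ h) (hd : 0 < detect lam σ n h) :
    ∃ (h' : List M) (t : ℝ), 0 < (σ h').work ∧ 0 < G.mass lam σ h' ∧
      ∀ s, (G.node lam σ h').real s = t * (G.node lam σ h).real s := by
  induction n generalizing h with
  | zero => rw [detect_zero] at hd; exact absurd hd (lt_irrefl _)
  | succ n ih =>
    by_cases hg : 0 < (σ h).work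
    · exact ⟨h, 1, hg, hm, fun s => (one_mul _).symm⟩
    · have hg0 : ((σ h).work : ℝ) = 0 := le_antisymm (not_lt.1 hg) (σ h).work.2.1
      rw [detect_succ, hg0, zero_mul, zero_add] at hd
      obtain ⟨m, -, hpos⟩ := Finset.exists_lt_of_sum_lt (f := fun _ => (0 : ℝ)) (by simpa using hd)
      have hq : 0 < (quiet lam σ h m).toReal :=
        pos_of_mul_pos_left hpos (detect_nonneg _ _ _ _)
      have hdm : 0 < detect lam σ n (h ++ [m]) := pos_of_mul_pos_right hpos hq.le
      have hnode : ∀ s, (G.node lam σ (h ++ [m])).real s =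
          (quiet lam σ h m).toReal * (G.node lam σ h).real s := by
        intro s
        rw [G.node_append_eq_push, G.push_real, hg0]
        ring
      have hmm : 0 < G.mass lam σ (h ++ [m]) := by
        rw [Game.mass, hnode]
        exact mul_pos hq hm
      obtain ⟨h', t, h1, h2, h3⟩ := ih hmm hdm
      refine ⟨h', t * (quiet lam σ h m).toReal, h1, h2, fun s => ?_⟩
      rw [h3, hnode, mul_assoc]

theorem Game.exists_work_pos_of_peril (hm : 0 < G.mass lam σ h) (hp : 0 < peril lam σ h) :
    ∃ (h' : List M), 0 < (σ h').work ∧ 0 < G.mass lam σ h' ∧ ∀ j x,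
      G.massMore lam σ j h ≤ x * G.mass lam σ h ↔ G.massMore lam σ j h' ≤ x * G.mass lam σ h' := by
  obtain ⟨n, hn⟩ := exists_lt_detect hp
  obtain ⟨h', t, h1, h2, h3⟩ := G.exists_work_pos hm hn
  refine ⟨h', h1, h2, fun j x => ?_⟩
  have ht : 0 < t := by
    rw [Game.mass, h3] at h2
    exact pos_of_mul_pos_left h2 hm.le
  rw [Game.massMore, Game.massMore, Game.mass, Game.mass, h3, h3]
  constructor
  · intro hle; nlinarith
  · intro hle
    by_contra hlt
    push Not at hlt
    nlinarith

end

section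

variable [Nonempty M] {G : Game A M Ω R P} {c : ℝ} {lam : unitInterval} {a : Assessment A M Ω}

theorem Game.IsWeakPBE.node_real (ha : G.IsWeakPBE c lam a) {h : List M}
    (hm : 0 < G.mass lam a.strategy h) (s : Set (Ω × Stream'.Seq A)) :
    (G.node lam a.strategy h).real s = G.mass lam a.strategy h * (a.belief h).real s := by
  rw [ha.node_eq (Game.onPath_of_mass_pos hm)]
  rw [measureReal_def, Measure.smul_apply, smul_eq_mul, ENNReal.toReal_mul]
  rfl

theorem Game.IsWeakPBE.echo_node_real (ha : G.IsWeakPBE c lam a) {h : List M}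
    (hm : 0 < G.mass lam a.strategy h) (m : M) :
    (G.echo a.strategy h m (G.node lam a.strategy h)).real Set.univ =
      G.mass lam a.strategy h * G.luckyReport a h m := by
  rw [ha.node_eq (Game.onPath_of_mass_pos hm), G.echo_smul, measureReal_def, Measure.smul_apply,
    smul_eq_mul, ENNReal.toReal_mul]
  rfl

theorem Game.IsWeakPBE.mass_append (ha : G.IsWeakPBE c lam a) {h : List M}
    (hm : 0 < G.mass lam a.strategy h) (m : M) :
    G.mass lam a.strategy (h ++ [m]) = (quiet lam a.strategy h m).toReal *
      G.mass lam a.strategy h + (a.strategy h).work * lam *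
        (G.mass lam a.strategy h * G.luckyReport a h m) := by
  rw [Game.mass, G.node_append_eq_push, G.push_real, ha.echo_node_real hm]
  rfl

/-- If more than `j + 1` signals are unlikely to be left at a history after which favourable coins
are possible, there is another such history at which they are still unlikely, more than `j`
signals are hardly more likely than before, and the probability of a later favourable coin is
bounded below. -/
theorem Game.IsWeakPBE.exists_le_peril (ha : G.IsWeakPBE c lam a) (hne : ∀ i, G.NonEthical i)
    (hc : 0 < c) (hlam : 0 < lam) {D : ℝ} (hcD : c ≤ D) (hRD : R + P ≤ D) {j : ℕ} {h : List M}
    (hm : 0 < G.mass lam a.strategy h) (hp : 0 < peril lam a.strategy h) {x η : ℝ} (hη : 0 < η)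
    (hx : G.massMore lam a.strategy j h ≤ x * G.mass lam a.strategy h)
    (hE : G.massMore lam a.strategy (j + 1) h ≤ η * G.mass lam a.strategy h) :
    ∃ h' : List M, 0 < G.mass lam a.strategy h' ∧ c / (8 * D) ≤ peril lam a.strategy h' ∧
      G.massMore lam a.strategy j h' ≤ (x + 4 * D / c * η) * G.mass lam a.strategy h' ∧
      G.massMore lam a.strategy (j + 1) h' ≤ 4 * D / c * η * G.mass lam a.strategy h' := by
  obtain ⟨h', hg, hm', hiff⟩ := G.exists_work_pos_of_peril hm hp
  rw [hiff] at hx hE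
  clear hiff hp hm
  rename' h => h₀, h' => h
  set σ := a.strategy with hσ
  have hD : 0 < D := hc.trans_le hcD
  set K := 4 * D / c with hK
  have hK1 : 1 ≤ K := by rw [hK, le_div_iff₀ hc]; linarith
  set E := moreThan A Ω (j + 1) with hEdef
  have hEm : MeasurableSet E := measurableSet_moreThan (j + 1)
  set p := G.mass lam σ h with hpdef
  set ν := (G.node lam σ h).restrict E with hν
  set ν' := (G.node lam σ h).restrict Eᶜ with hν'
  have hsplit : G.node lam σ h = ν + ν' := (Measure.restrict_add_restrict_compl hEm).symm
  have hν'E : ν' E = 0 := by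
    rw [hν', Measure.restrict_apply hEm, Set.inter_compl_self, measure_empty]
  have hνu : ν.real Set.univ ≤ η * p := by
    rw [hν, measureReal_restrict_apply_univ]
    exact hE
  have hν'B : ν'.real (moreThan A Ω j) ≤ x * p := by
    refine le_trans ?_ hx
    rw [Game.massMore, measureReal_def, measureReal_def]
    exact ENNReal.toReal_mono (measure_ne_top _ _) (Measure.restrict_apply_le _ _)
  have hq := G.luckyReport_nonneg (a := a) h
  have hsum := ha.le_sum_luckyReport_mul_peril hne hc hg
  -- A favourable coin is followed with positive probability by a report `m` that carries a high
  -- peril and is not a strong sign of more than `j + 1` signals.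
  obtain ⟨m, hqm, hpm, hem⟩ : ∃ m, 0 < G.luckyReport a h m ∧ c / (8 * D) ≤ peril lam σ (h ++ [m]) ∧
      (G.echo σ h m ν).real Set.univ ≤ K * (η * p) * G.luckyReport a h m := by
    by_contra hno
    push Not at hno
    have hle : ∀ m ∈ Finset.univ, (η * p) * (G.luckyReport a h m * peril lam σ (h ++ [m])) ≤
        (η * p) * (c / (8 * D)) * G.luckyReport a h m +
          (c / (4 * D)) * (G.echo σ h m ν).real Set.univ := by
      intro m _
      have he : 0 ≤ (G.echo σ h m ν).real Set.univ := measureReal_nonneg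
      have hηp : 0 < η * p := mul_pos hη hm'
      rcases (hq m).eq_or_lt with h0 | h0
      · rw [← h0]
        simp only [zero_mul, mul_zero, zero_add]
        positivity
      · by_cases hpe : c / (8 * D) ≤ peril lam σ (h ++ [m])
        · have h1 := (hno m h0 hpe).le
          have h2 : (η * p) * G.luckyReport a h m ≤
              (c / (4 * D)) * (G.echo σ h m ν).real Set.univ := by
            have h3 := mul_le_mul_of_nonneg_left h1 (by positivity : 0 ≤ c / (4 * D))
            have h4 : c / (4 * D) * (K * (η * p) * G.luckyReport a h m) =
                (η * p) * G.luckyReport a h m := by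
              rw [hK]; field_simp
            linarith
          have h3 : (η * p) * (G.luckyReport a h m * peril lam σ (h ++ [m])) ≤
              (η * p) * G.luckyReport a h m :=
            mul_le_mul_of_nonneg_left (mul_le_of_le_one_right h0.le (peril_le_one _ _ _)) hηp.le
          have h4 : 0 ≤ (η * p) * (c / (8 * D)) * G.luckyReport a h m := by positivity
          linarith
        · push Not at hpe
          have h3 : (η * p) * (G.luckyReport a h m * peril lam σ (h ++ [m])) ≤
              (η * p) * (G.luckyReport a h m * (c / (8 * D))) := by gcongr
          have h4 : 0 ≤ c / (4 * D) * (G.echo σ h m ν).real Set.univ := by positivity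
          linarith
    have htot := Finset.sum_le_sum hle
    rw [Finset.sum_add_distrib, ← Finset.mul_sum, ← Finset.mul_sum, ← Finset.mul_sum,
      G.sum_luckyReport, G.sum_echo_real, mul_one] at htot
    have hηp : 0 < η * p := mul_pos hη hm'
    have h5 : c / (4 * D) * ν.real Set.univ ≤ c / (4 * D) * (η * p) := by gcongr
    have h6 : (η * p) * (∑ m : M, G.luckyReport a h m * peril lam σ (h ++ [m])) ≤
        (η * p) * (c / (8 * D) + c / (4 * D)) := by linarith
    have h7 := le_of_mul_le_mul_left h6 hηp
    have hs0 : 0 ≤ ∑ m : M, G.luckyReport a h m * peril lam σ (h ++ [m]) :=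
      Finset.sum_nonneg fun m _ => mul_nonneg (hq m) (peril_nonneg _ _ _)
    have h8 : c ≤ 2 * D * (c / (8 * D) + c / (4 * D)) :=
      hsum.trans (by gcongr)
    have h9 : 2 * D * (c / (8 * D) + c / (4 * D)) = 3 / 4 * c := by field_simp; ring
    linarith
  have hmass := ha.mass_append hm' m
  rw [← hσ, ← hpdef] at hmass
  have hg' : (0 : ℝ) < (σ h).work := hg
  have hl' : (0 : ℝ) < lam := hlam
  have hquiet : 0 ≤ (quiet lam σ h m).toReal := ENNReal.toReal_nonneg
  have hH : (G.push lam σ h m ν).real Set.univ ≤ K * η * G.mass lam σ (h ++ [m]) := by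
    rw [G.push_real, hmass]
    have h1 : (quiet lam σ h m).toReal * ν.real Set.univ ≤
        (quiet lam σ h m).toReal * (K * (η * p)) := by
      have h2 : η * p ≤ K * (η * p) := le_mul_of_one_le_left (mul_pos hη hm').le hK1
      gcongr
      linarith
    have h3 : ((σ h).work : ℝ) * lam * (G.echo σ h m ν).real Set.univ ≤
        (σ h).work * lam * (K * (η * p) * G.luckyReport a h m) := by gcongr
    nlinarith
  have hnode : G.node lam σ (h ++ [m]) = G.push lam σ h m ν + G.push lam σ h m ν' := by
    rw [G.node_append_eq_push, hsplit, G.push_add]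
  have hle : ∀ s, (G.push lam σ h m ν).real s ≤ (G.push lam σ h m ν).real Set.univ :=
    fun s => measureReal_mono (Set.subset_univ s)
  refine ⟨h ++ [m], ?_, hpm, ?_, ?_⟩
  · rw [hmass]
    have : 0 < ((σ h).work : ℝ) * lam * (p * G.luckyReport a h m) :=
      mul_pos (mul_pos hg' hl') (mul_pos hm' hqm)
    nlinarith [mul_nonneg hquiet hm'.le]
  · rw [Game.massMore, hnode, measureReal_add_apply, G.push_moreThan m hν'E]
    have h1 := hle (moreThan A Ω j)
    have h2 : (quiet lam σ h m).toReal * ν'.real (moreThan A Ω j) ≤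
        x * G.mass lam σ (h ++ [m]) := by
      have hx0 : 0 ≤ x := by
        by_contra hneg
        push Not at hneg
        have : 0 ≤ G.massMore lam σ j h := measureReal_nonneg
        nlinarith
      have h3 : (quiet lam σ h m).toReal * ν'.real (moreThan A Ω j) ≤
          (quiet lam σ h m).toReal * (x * p) := by gcongr
      have h4 : 0 ≤ ((σ h).work : ℝ) * lam * (p * G.luckyReport a h m) :=
        mul_nonneg (mul_pos hg' hl').le (mul_nonneg hm'.le hqm.le)
      rw [hmass]
      nlinarith [mul_nonneg hx0 h4]
    rw [add_mul]
    linarith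
  · rw [Game.massMore, hnode, measureReal_add_apply, measureReal_def (G.push lam σ h m ν'),
      G.push_moreThan_succ m hν'E, ENNReal.toReal_zero, add_zero]
    exact (hle _).trans hH

end

end

/-! ### The accounting inequality -/

section

variable {A M Ω : Type*} [Fintype M] [MeasurableSpace M] [MeasurableSpace Ω] {R P : ℝ}

section

variable [Nonempty M] {G : Game A M Ω R P} {c : ℝ} {lam : unitInterval} {a : Assessment A M Ω}

/-- If at a relevant history more than `j` signals are left with probability at least
`(1 - ε) * f`, then favourable coins have contributed little to the probability of reaching
this history. -/
theorem Game.budget_nonneg {σ : List M → Plan A M} {ε f y r : ℝ} {j : ℕ} {h : List M}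
    (hε0 : 0 < ε) (hε : ε ≤ 1 / 6) (hf : 0 < f) (hyf : y ≤ ε * f)
    (hmore : 0 < G.mass lam σ h → G.massMore lam σ (j + 1) h ≤ y * G.mass lam σ h →
      (1 - ε) * f * G.mass lam σ h ≤ G.massMore lam σ j h)
    {ν ν' : Measure (Ω × Stream'.Seq A)} [IsFiniteMeasure ν] [IsFiniteMeasure ν']
    (hnode : G.node lam σ h = ν + ν') (hν'E : ν' (moreThan A Ω (j + 1)) = 0)
    (hν'B : ν'.real (moreThan A Ω j) ≤ r * f) (hr : 0 ≤ r) (hrm : r ≤ G.mass lam σ h)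
    (hν : ν.real Set.univ ≤ y * G.mass lam σ h) :
    0 ≤ 3 * ε * r - (G.mass lam σ h - r) := by
  have hle : ∀ s, ν.real s ≤ ν.real Set.univ := fun s => measureReal_mono (Set.subset_univ s)
  rcases (G.mass_nonneg (lam := lam) (σ := σ) (h := h)).eq_or_lt with h0 | h0
  · have : r = 0 := le_antisymm (h0 ▸ hrm) hr
    rw [← h0, this]; simp
  · have hE : G.massMore lam σ (j + 1) h ≤ y * G.mass lam σ h := by
      rw [Game.massMore, hnode, measureReal_add_apply, measureReal_def ν', hν'E,
        ENNReal.toReal_zero, add_zero]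
      exact (hle _).trans hν
    have h1 := hmore h0 hE
    have h2 : G.massMore lam σ j h ≤ y * G.mass lam σ h + r * f := by
      rw [Game.massMore, hnode, measureReal_add_apply]
      exact add_le_add ((hle _).trans hν) hν'B
    have h3 : (1 - 2 * ε) * G.mass lam σ h * f ≤ r * f := by nlinarith
    have h4 := le_of_mul_le_mul_right h3 hf
    nlinarith

/-- Suppose that at all relevant histories more than `j` signals are left with probability at least
`(1 - ε) * f`, while initially this probability is `f`. Then the probability of favourable coins is
small. Here `r` is the probability of reaching `h` without favourable coins, `ν` is the part of the
measure at `h` that comes from more than `j + 1` initial signals, and `ν'` is the remaining part.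
The quantity `3 * ε * r - (G.mass lam a.strategy h - r)` is a budget: it is nonnegative at all
relevant histories, and each favourable coin that is followed by a relevant history uses up the
probability with which it occurs. -/
theorem Game.IsWeakPBE.mul_detect_le (ha : G.IsWeakPBE c lam a) {κ ε f y B : ℝ} {j : ℕ}
    (hκ0 : 0 ≤ κ) (hκ1 : κ ≤ 1) (hε0 : 0 < ε) (hε : ε ≤ 1 / 6) (hf : 0 < f) (hy : 0 < y)
    (hyf : y ≤ ε * f) (hB : 2 ≤ B * y)
    (hinc : ∀ h, 0 < G.mass lam a.strategy h → 0 < (a.strategy h).work → ∀ s : Finset M,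
      (∀ m, m ∉ s → peril lam a.strategy (h ++ [m]) ≤ 0) → κ ≤ ∑ m ∈ s, G.luckyReport a h m)
    (hmore : ∀ h, 0 < G.mass lam a.strategy h → 0 < peril lam a.strategy h →
      G.massMore lam a.strategy (j + 1) h ≤ y * G.mass lam a.strategy h →
      (1 - ε) * f * G.mass lam a.strategy h ≤ G.massMore lam a.strategy j h)
    (n : ℕ) (h : List M) (ν ν' : Measure (Ω × Stream'.Seq A)) [IsFiniteMeasure ν]
    [IsFiniteMeasure ν'] (r : ℝ) (hnode : G.node lam a.strategy h = ν + ν')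
    (hν'E : ν' (moreThan A Ω (j + 1)) = 0) (hν'B : ν'.real (moreThan A Ω j) ≤ r * f) (hr : 0 ≤ r)
    (hrm : r ≤ G.mass lam a.strategy h) (hp : 0 < peril lam a.strategy h)
    (hν : ν.real Set.univ ≤ y * G.mass lam a.strategy h) :
    κ * (r * detect lam a.strategy n h) ≤
      3 * ε * r - (G.mass lam a.strategy h - r) + B * ν.real Set.univ := by
  classical
  set σ := a.strategy with hσ
  have hB0 : 0 < B := by
    by_contra hneg
    push Not at hneg
    nlinarith
  induction n generalizing h ν ν' r with
  | zero =>
    have hbudget := G.budget_nonneg hε0 hε hf hyf (fun h0 => hmore h h0 hp) hnode hν'E hν'B hr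
      hrm hν
    rw [detect_zero]
    have : 0 ≤ B * ν.real Set.univ := mul_nonneg hB0.le measureReal_nonneg
    linarith
  | succ n ih =>
    have hbudget := G.budget_nonneg hε0 hε hf hyf (fun h0 => hmore h h0 hp) hnode hν'E hν'B hr
      hrm hν
    set p := G.mass lam σ h with hpdef
    set b := 3 * ε * r - (p - r) with hb
    set qt : M → ℝ := fun m => (quiet lam σ h m).toReal with hqt
    set e : M → ℝ := fun m => (σ h).work * lam *
      (G.echo σ h m (G.node lam σ h)).real Set.univ with he
    have hqt0 : ∀ m, 0 ≤ qt m := fun m => ENNReal.toReal_nonneg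
    have hwl : 0 ≤ ((σ h).work : ℝ) * lam := mul_nonneg (σ h).work.2.1 lam.2.1
    have he0 : ∀ m, 0 ≤ e m := fun m => mul_nonneg hwl measureReal_nonneg
    have hmass : ∀ m, G.mass lam σ (h ++ [m]) = qt m * p + e m := by
      intro m
      rw [Game.mass, G.node_append_eq_push, G.push_real]
      rfl
    set s : Finset M := Finset.univ.filter fun m => 0 < peril lam σ (h ++ [m]) with hs
    -- the favourable coins in this round that are followed by relevant histories
    have hcoin : κ * (r * ((σ h).work * lam)) ≤ ∑ m ∈ s, e m := by
      by_cases hwork : 0 < (σ h).work ∧ 0 < p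
      · have h1 := hinc h hwork.2 hwork.1 s (fun m hm => by simpa [hs] using hm)
        have h2 : ∑ m ∈ s, e m = ((σ h).work * lam) * (p * ∑ m ∈ s, G.luckyReport a h m) := by
          rw [Finset.mul_sum, Finset.mul_sum]
          refine Finset.sum_congr rfl fun m _ => ?_
          simp only [he]
          rw [ha.echo_node_real hwork.2]
        have h3 : r * κ ≤ p * ∑ m ∈ s, G.luckyReport a h m :=
          mul_le_mul hrm h1 hκ0 hwork.2.le
        rw [h2]
        calc κ * (r * ((σ h).work * lam)) = ((σ h).work * lam) * (r * κ) := by ring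
          _ ≤ _ := mul_le_mul_of_nonneg_left h3 hwl
      · have h0 : r * ((σ h).work * lam) = 0 := by
          rcases not_and_or.1 hwork with hw | hw
          · have : ((σ h).work : ℝ) = 0 := le_antisymm (not_lt.1 hw) (σ h).work.2.1
            rw [this]; ring
          · have : r = 0 := le_antisymm (hrm.trans (not_lt.1 hw)) hr
            rw [this]; ring
        rw [h0, mul_zero]
        exact Finset.sum_nonneg fun m _ => he0 m
    have hterm : ∀ m, κ * (qt m * r * detect lam σ n (h ++ [m])) + (if m ∈ s then e m else 0) ≤
        qt m * b + B * (G.push lam σ h m ν).real Set.univ := by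
      intro m
      have hpush0 : 0 ≤ (G.push lam σ h m ν).real Set.univ := measureReal_nonneg
      by_cases hms : m ∈ s
      · rw [if_pos hms]
        have hpm : 0 < peril lam σ (h ++ [m]) := by simpa [hs] using hms
        have hnode' : G.node lam σ (h ++ [m]) = G.push lam σ h m ν + G.push lam σ h m ν' := by
          rw [G.node_append_eq_push, hnode, G.push_add]
        have hrm' : qt m * r ≤ G.mass lam σ (h ++ [m]) := by
          rw [hmass]
          have := mul_le_mul_of_nonneg_left hrm (hqt0 m)
          linarith [he0 m]
        by_cases hgood : (G.push lam σ h m ν).real Set.univ ≤ y * G.mass lam σ (h ++ [m])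
        · have hB' : (G.push lam σ h m ν').real (moreThan A Ω j) ≤ qt m * r * f := by
            rw [G.push_moreThan m hν'E, mul_assoc]
            exact mul_le_mul_of_nonneg_left hν'B (hqt0 m)
          have := ih (h ++ [m]) (G.push lam σ h m ν) (G.push lam σ h m ν') (qt m * r)
            (G.push_moreThan_succ m hν'E) hB' (mul_nonneg (hqt0 m) hr) hnode' hrm' hpm hgood
          rw [hmass] at this
          have h1 : 3 * ε * (qt m * r) - (qt m * p + e m - qt m * r) = qt m * b - e m := by
            rw [hb]; ring
          linarith
        · push Not at hgood
          have h1 : κ * (qt m * r * detect lam σ n (h ++ [m])) ≤ G.mass lam σ (h ++ [m]) := by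
            have h2 : qt m * r * detect lam σ n (h ++ [m]) ≤ qt m * r :=
              mul_le_of_le_one_right (mul_nonneg (hqt0 m) hr) (detect_le_one _ _ _ _)
            have h3 : 0 ≤ qt m * r * detect lam σ n (h ++ [m]) :=
              mul_nonneg (mul_nonneg (hqt0 m) hr) (detect_nonneg _ _ _ _)
            exact (mul_le_of_le_one_left h3 hκ1).trans (h2.trans hrm')
          have h2 : e m ≤ G.mass lam σ (h ++ [m]) := by
            rw [hmass]
            have := mul_nonneg (hqt0 m) (G.mass_nonneg (lam := lam) (σ := σ) (h := h))
            linarith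
          have h3 : 0 ≤ qt m * b := mul_nonneg (hqt0 m) hbudget
          have h4 : 2 * G.mass lam σ (h ++ [m]) ≤ B * y * G.mass lam σ (h ++ [m]) :=
            mul_le_mul_of_nonneg_right hB G.mass_nonneg
          have h5 := mul_le_mul_of_nonneg_left hgood.le hB0.le
          linarith
      · rw [if_neg hms, add_zero]
        have hd0 : detect lam σ n (h ++ [m]) = 0 := by
          have h1 : peril lam σ (h ++ [m]) ≤ 0 := by simpa [hs] using hms
          exact le_antisymm ((detect_le_peril _ _ _ _).trans h1) (detect_nonneg _ _ _ _)
        rw [hd0, mul_zero, mul_zero]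
        have h3 : 0 ≤ qt m * b := mul_nonneg (hqt0 m) hbudget
        have h4 : 0 ≤ B * (G.push lam σ h m ν).real Set.univ := by positivity
        linarith
    have htot := Finset.sum_le_sum fun m (_ : m ∈ Finset.univ) => hterm m
    rw [Finset.sum_add_distrib, Finset.sum_add_distrib, ← Finset.mul_sum, ← Finset.mul_sum,
      ← Finset.sum_mul, G.sum_push_real] at htot
    have hif : ∑ m : M, (if m ∈ s then e m else 0) = ∑ m ∈ s, e m := by
      rw [← Finset.sum_filter, Finset.filter_mem_eq_inter, Finset.univ_inter]
    rw [hif] at htot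
    have hqsum : ∑ m : M, qt m ≤ 1 := by
      have := sum_quiet_toReal lam σ h
      simp only [hqt]
      linarith
    have h1 : (∑ m : M, qt m) * b ≤ b := mul_le_of_le_one_left hbudget hqsum
    have h2 : κ * (r * detect lam σ (n + 1) h) = κ * (r * ((σ h).work * lam)) +
        κ * ∑ m : M, qt m * r * detect lam σ n (h ++ [m]) := by
      rw [detect_succ, mul_add, mul_add, Finset.mul_sum]
      congr 3
      funext m
      simp only [hqt]
      ring
    rw [h2]
    linarith

end

end

/-! ### Thresholds -/

section

variable {A M Ω : Type*} [Fintype M] [MeasurableSpace M] [MeasurableSpace Ω] {R P : ℝ}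
  [Nonempty M] {G : Game A M Ω R P} {c : ℝ} {lam : unitInterval} {a : Assessment A M Ω}

/-- At a history with high peril at which more than `j + 1` signals are unlikely, the probability
that more than `j` signals are left drops by a factor at some later history, while more than
`j + 1` signals remain unlikely. -/
theorem Game.IsWeakPBE.exists_massMore_le (ha : G.IsWeakPBE c lam a) (hne : ∀ i, G.NonEthical i)
    (hc : 0 < c) {D : ℝ} (hcD : c ≤ D) (hRD : R + P ≤ D) {j : ℕ} {h : List M} {δ F : ℝ}
    (hδ : 0 < δ) (hδ1 : δ ≤ 1) (hF : 0 < F) (hm : 0 < G.mass lam a.strategy h)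
    (hp : δ ≤ peril lam a.strategy h) (hFh : F * G.mass lam a.strategy h ≤
      G.massMore lam a.strategy j h) {x η : ℝ} (hη : 0 < η)
    (hx : G.massMore lam a.strategy j h ≤ x * G.mass lam a.strategy h)
    (hE : G.massMore lam a.strategy (j + 1) h ≤ η * G.mass lam a.strategy h)
    (hηF : 16 * D / (c * δ) * η ≤ c * δ / (16 * D) * F) :
    ∃ h' : List M, 0 < G.mass lam a.strategy h' ∧ 0 < peril lam a.strategy h' ∧
      G.massMore lam a.strategy j h' ≤ (1 - c * δ / (16 * D)) * x * G.mass lam a.strategy h' ∧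
      G.massMore lam a.strategy (j + 1) h' ≤
        16 * D / (c * δ) * η * G.mass lam a.strategy h' := by
  have hD : 0 < D := hc.trans_le hcD
  set σ := a.strategy with hσ
  set ε := c * δ / (16 * D) with hε
  set y := 16 * D / (c * δ) * η with hy
  set p := G.mass lam σ h with hpdef
  have hy0 : 0 < y := by positivity
  have hε0 : 0 < ε := by positivity
  have hcδ : c * δ ≤ D := (mul_le_of_le_one_right hc.le hδ1).trans hcD
  have hε1 : ε ≤ 1 / 16 := by
    rw [hε, div_le_div_iff₀ (by positivity) (by norm_num)]
    linarith
  by_contra hno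
  push Not at hno
  set f := G.massMore lam σ j h / p with hf
  have hfp : G.massMore lam σ j h = p * f := by rw [hf]; field_simp
  have hfF : F ≤ f := by rw [hf, le_div_iff₀ hm]; exact hFh
  have hfx : f ≤ x := by rw [hf, div_le_iff₀ hm]; exact hx
  have hf0 : 0 < f := hF.trans_le hfF
  have hmore : ∀ h, 0 < G.mass lam σ h → 0 < peril lam σ h →
      G.massMore lam σ (j + 1) h ≤ y * G.mass lam σ h →
      (1 - ε) * f * G.mass lam σ h ≤ G.massMore lam σ j h := by
    intro h' hm' hp' hy'
    by_contra hlt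
    push Not at hlt
    have h1 : (1 - ε) * f * G.mass lam σ h' ≤ (1 - ε) * x * G.mass lam σ h' :=
      mul_le_mul_of_nonneg_right (mul_le_mul_of_nonneg_left hfx (by linarith)) hm'.le
    exact absurd hy' (not_le.2 (hno h' hm' hp' (hlt.le.trans h1)))
  have hinc : ∀ h, 0 < G.mass lam σ h → 0 < (σ h).work → ∀ s : Finset M,
      (∀ m, m ∉ s → peril lam σ (h ++ [m]) ≤ 0) → c / D ≤ ∑ m ∈ s, G.luckyReport a h m := by
    intro h _ hg s hs
    rw [div_le_iff₀ hD, mul_comm]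
    refine (ha.le_sum_luckyReport hne hc hg s hs).trans ?_
    exact mul_le_mul_of_nonneg_right hRD (Finset.sum_nonneg fun m _ => G.luckyReport_nonneg h m)
  have hEm : MeasurableSet (moreThan A Ω (j + 1)) := measurableSet_moreThan (j + 1)
  obtain ⟨n, hn⟩ := exists_lt_detect ((half_lt_self hδ).trans_le hp)
  have hν : ((G.node lam σ h).restrict (moreThan A Ω (j + 1))).real Set.univ ≤ η * p := by
    rw [measureReal_restrict_apply_univ]
    exact hE
  have hηy : η ≤ y := by
    rw [hy]
    refine le_mul_of_one_le_left hη.le ?_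
    rw [le_div_iff₀ (by positivity)]
    linarith
  have key := ha.mul_detect_le (κ := c / D) (ε := ε) (f := f) (y := y) (B := 2 / y) (j := j)
    (by positivity) (by rw [div_le_one hD]; exact hcD) hε0 (by linarith) hf0 hy0
    (hηF.trans (mul_le_mul_of_nonneg_left hfF hε0.le)) (by rw [div_mul_cancel₀ _ hy0.ne'])
    hinc hmore n h ((G.node lam σ h).restrict (moreThan A Ω (j + 1)))
    ((G.node lam σ h).restrict (moreThan A Ω (j + 1))ᶜ) p
    (Measure.restrict_add_restrict_compl hEm).symm
    (by rw [Measure.restrict_apply hEm, Set.inter_compl_self, measure_empty])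
    (by
      rw [← hfp, Game.massMore, measureReal_def, measureReal_def]
      exact ENNReal.toReal_mono (measure_ne_top _ _) (Measure.restrict_apply_le _ _))
    hm.le le_rfl (hδ.trans_le hp) (hν.trans (mul_le_mul_of_nonneg_right hηy hm.le))
  have h1 : 2 / y * ((G.node lam σ h).restrict (moreThan A Ω (j + 1))).real Set.univ ≤
      2 / y * (η * p) := mul_le_mul_of_nonneg_left hν (by positivity)
  have h2 : 2 / y * (η * p) = 2 * ε * p := by
    rw [hy, hε]; field_simp
  have h3 : c / D * (p * (δ / 2)) ≤ c / D * (p * detect lam σ n h) := by gcongr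
  have h4 : c / D * (p * (δ / 2)) = 8 * ε * p := by
    rw [hε]; field_simp; ring
  have h5 : 0 < ε * p := mul_pos hε0 hm
  linarith

end

/-- For every `j` there is a lower bound, depending only on the parameters, on the probability that
more than `j` signals are left at any history after which favourable coins are possible. -/
theorem exists_threshold (R P c : ℝ) (hc : 0 < c) (lam : unitInterval) (hlam : 0 < lam) (j : ℕ) :
    ∃ F : ℝ, 0 < F ∧ ∀ (A M Ω : Type*) [Fintype M] [Nonempty M] [MeasurableSpace M]
      [MeasurableSpace Ω] (G : Game A M Ω R P) (a : Assessment A M Ω),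
      (∀ i, G.NonEthical i) → G.IsWeakPBE c lam a → ∀ h : List M, 0 < G.mass lam a.strategy h →
        0 < peril lam a.strategy h →
          F * G.mass lam a.strategy h ≤ G.massMore lam a.strategy j h := by
  set D := max (R + P) c with hDdef
  have hcD : c ≤ D := le_max_right _ _
  have hRD : R + P ≤ D := le_max_left _ _
  have hD : 0 < D := hc.trans_le hcD
  induction j with
  | zero =>
    refine ⟨c / D, by positivity, ?_⟩
    intro A M Ω _ _ _ _ G a hne ha h hm hp
    obtain ⟨h', hg, hm', hiff⟩ := G.exists_work_pos_of_peril hm hp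
    have h1 := ha.le_moreThan_zero hne hc hg
    have h2 : c / D * G.mass lam a.strategy h' ≤ G.massMore lam a.strategy 0 h' := by
      have h3 : c ≤ D * (a.belief h').real (moreThan A Ω 0) :=
        h1.trans (mul_le_mul_of_nonneg_right hRD measureReal_nonneg)
      rw [Game.massMore, ha.node_real hm', mul_comm]
      refine mul_le_mul_of_nonneg_left ?_ hm'.le
      rw [div_le_iff₀ hD]
      linarith
    by_contra hlt
    push Not at hlt
    have h3 := (hiff 0 (G.massMore lam a.strategy 0 h / G.mass lam a.strategy h)).1
      (by rw [div_mul_cancel₀ _ hm.ne'])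
    have h4 : G.massMore lam a.strategy 0 h / G.mass lam a.strategy h < c / D := by
      rwa [div_lt_iff₀ hm]
    nlinarith
  | succ j ih =>
    obtain ⟨F, hF, hFall⟩ := ih
    set δ := c / (8 * D) with hδ
    have hδ0 : 0 < δ := by positivity
    have hδ1 : δ ≤ 1 := by rw [hδ, div_le_one (by positivity)]; linarith
    set ε := c * δ / (16 * D) with hε
    have hε0 : 0 < ε := by positivity
    have hcδ : c * δ ≤ D := (mul_le_of_le_one_right hc.le hδ1).trans hcD
    have hε1 : ε ≤ 1 / 16 := by
      rw [hε, div_le_div_iff₀ (by positivity) (by norm_num)]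
      linarith
    set K := 4 * D / c with hK
    set C := 16 * D / (c * δ) with hC
    have hK4 : 4 ≤ K := by rw [hK, le_div_iff₀ hc]; linarith
    have hC16 : 16 ≤ C := by rw [hC, le_div_iff₀ (by positivity)]; linarith
    have hCK : 1 ≤ C * K := by nlinarith
    obtain ⟨n, hn⟩ := exists_pow_lt_of_lt_one hF (by linarith : 1 - ε / 2 < 1)
    refine ⟨ε * F / (C * K) ^ n, by positivity, ?_⟩
    intro A M Ω _ _ _ _ G a hne ha h hm hp
    by_contra hlt
    push Not at hlt
    have hF' := hFall A M Ω G a hne ha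
    have iter : ∀ k, k ≤ n → ∃ h' : List M, 0 < G.mass lam a.strategy h' ∧
        0 < peril lam a.strategy h' ∧
        G.massMore lam a.strategy j h' ≤ (1 - ε / 2) ^ k * G.mass lam a.strategy h' ∧
        G.massMore lam a.strategy (j + 1) h' ≤
          (C * K) ^ k * (ε * F / (C * K) ^ n) * G.mass lam a.strategy h' := by
      intro k
      induction k with
      | zero =>
        intro _
        refine ⟨h, hm, hp, ?_, ?_⟩
        · rw [pow_zero, one_mul]; exact G.massMore_le_mass j
        · rw [pow_zero, one_mul]; exact hlt.le
      | succ k ihk =>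
        intro hk
        obtain ⟨h₁, hm₁, hp₁, hx₁, hE₁⟩ := ihk (by omega)
        set x := (1 - ε / 2) ^ k with hx
        set η := (C * K) ^ k * (ε * F / (C * K) ^ n) with hη
        have hη0 : 0 < η := by positivity
        have hηle : C * (K * η) ≤ ε * F := by
          have e1 : C * (K * η) = (C * K) ^ (k + 1) / (C * K) ^ n * (ε * F) := by
            rw [hη, pow_succ]; field_simp
          rw [e1]
          refine mul_le_of_le_one_left (by positivity) ?_
          rw [div_le_one (by positivity)]
          exact pow_le_pow_right₀ hCK hk
        have hFx : F ≤ x := le_of_mul_le_mul_right ((hF' h₁ hm₁ hp₁).trans hx₁) hm₁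
        obtain ⟨h₂, hm₂, hp₂, hx₂, hE₂⟩ :=
          ha.exists_le_peril hne hc hlam hcD hRD hm₁ hp₁ hη0 hx₁ hE₁
        obtain ⟨h₃, hm₃, hp₃, hx₃, hE₃⟩ := ha.exists_massMore_le hne hc hcD hRD hδ0 hδ1 hF hm₂ hp₂
          (hF' h₂ hm₂ (hδ0.trans_le hp₂)) (mul_pos (by positivity) hη0) hx₂ hE₂ hηle
        refine ⟨h₃, hm₃, hp₃, hx₃.trans (mul_le_mul_of_nonneg_right ?_ hm₃.le),
          hE₃.trans (mul_le_mul_of_nonneg_right (le_of_eq ?_) hm₃.le)⟩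
        · -- the slack in the second step is small compared with `F`, hence with `x`
          have e1 : 16 * (K * η) ≤ ε * x := by
            have : 16 * (K * η) ≤ C * (K * η) :=
              mul_le_mul_of_nonneg_right hC16 (by positivity)
            exact this.trans (hηle.trans (mul_le_mul_of_nonneg_left hFx hε0.le))
          have e2 : 0 < x := hF.trans_le hFx
          rw [pow_succ, ← hx]
          change (1 - ε) * (x + K * η) ≤ x * (1 - ε / 2)
          nlinarith [mul_pos hε0 e2, mul_pos (mul_pos (by linarith : 0 < K) hη0) hε0]
        · rw [hη, pow_succ]; ring
    obtain ⟨h', hm', hp', hx', -⟩ := iter n le_rfl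
    have h1 := le_of_mul_le_mul_right ((hF' h' hm' hp').trans hx') hm'
    linarith

section

variable {A M Ω : Type*} [Fintype M] [MeasurableSpace M] [MeasurableSpace Ω] {R P : ℝ}
  {G : Game A M Ω R P} {lam : unitInterval}

theorem Game.mass_nil (σ : List M → Plan A M) : G.mass lam σ [] = 1 := by
  rw [Game.mass, G.node_nil, probReal_univ]

theorem Game.massMore_nil (σ : List M → Plan A M) (j : ℕ) :
    G.massMore lam σ j [] = G.atLeast (j + 1) := by
  rw [Game.massMore, G.node_nil, G.atLeast_succ]

/-- If no favourable coin is possible at the beginning, then no agent ever works. -/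
theorem Game.work_eq_zero {σ : List M → Plan A M} (hlam : 0 < lam) (h0 : peril lam σ [] ≤ 0)
    (h : List M) (hm : 0 < G.mass lam σ h) : ((σ h).work : ℝ) = 0 := by
  have hl : (0 : ℝ) < lam := hlam
  have hwork : ∀ h, peril lam σ h ≤ 0 → ((σ h).work : ℝ) = 0 ∧
      ∀ m, (quiet lam σ h m).toReal = 0 ∨ peril lam σ (h ++ [m]) ≤ 0 := by
    intro h hp
    have hd : ∀ n, detect lam σ n h ≤ 0 := fun n => (detect_le_peril lam σ n h).trans hp
    have hs : ∀ n, ∀ m ∈ Finset.univ,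
        0 ≤ (quiet lam σ h m).toReal * detect lam σ n (h ++ [m]) := fun n m _ =>
      mul_nonneg ENNReal.toReal_nonneg (detect_nonneg _ _ _ _)
    have hw : 0 ≤ ((σ h).work : ℝ) * lam := mul_nonneg (σ h).work.2.1 hl.le
    have hterm : ∀ n m, (quiet lam σ h m).toReal * detect lam σ n (h ++ [m]) ≤ 0 := by
      intro n m
      have h1 := hd (n + 1)
      rw [detect_succ] at h1
      have h2 := Finset.single_le_sum (hs n) (Finset.mem_univ m)
      linarith
    constructor
    · have h1 := hd 1
      rw [detect_succ] at h1
      have h2 := Finset.sum_nonneg (hs 0)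
      have h3 : ((σ h).work : ℝ) * lam = 0 := by linarith
      exact (mul_eq_zero.1 h3).resolve_right hl.ne'
    · intro m
      by_contra! hcon
      obtain ⟨hq, hpm⟩ := hcon
      obtain ⟨n, hn⟩ := exists_lt_detect hpm
      have hq' : 0 < (quiet lam σ h m).toReal := lt_of_le_of_ne ENNReal.toReal_nonneg hq.symm
      exact absurd (hterm n m) (not_le.2 (mul_pos hq' hn))
  have hall : ∀ h, 0 < G.mass lam σ h → peril lam σ h ≤ 0 := by
    intro h
    induction h using List.reverseRecOn with
    | nil => exact fun _ => h0
    | append_singleton h m ih =>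
      intro hm
      rw [Game.mass, G.node_append_eq_push, G.push_real] at hm
      have hq : (G.echo σ h m (G.node lam σ h)).real Set.univ ≤ G.mass lam σ h := by
        rw [Game.mass, measureReal_def, measureReal_def]
        exact ENNReal.toReal_mono (measure_ne_top _ _) (G.echo_univ_le m _)
      rcases (G.mass_nonneg (lam := lam) (σ := σ) (h := h)).eq_or_lt with hz | hpos
      · have e1 : (G.echo σ h m (G.node lam σ h)).real Set.univ = 0 :=
          le_antisymm (hz ▸ hq) measureReal_nonneg
        have e2 : (G.node lam σ h).real Set.univ = 0 := hz.symm
        rw [e1, e2] at hm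
        simp at hm
      · obtain ⟨hw, hqm⟩ := hwork h (ih hpos)
        refine (hqm m).resolve_left fun hq0 => ?_
        rw [hq0, hw] at hm
        simp at hm
  exact (hwork h (hall h hm)).1

theorem Game.Informative.peril_pos {a : Assessment A M Ω} (hlam : 0 < lam)
    (hinf : G.Informative lam a) : 0 < peril lam a.strategy [] := by
  by_contra hnot
  push Not at hnot
  obtain ⟨i, hi⟩ := hinf
  refine hi.ne' ?_
  rw [Game.workProb]
  have hlen : ∀ n, ∀ᵐ x ∂(G.stageLaw lam a.strategy n), x.1.length = n := by
    intro n
    induction n with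
    | zero =>
      rw [Game.stageLaw]
      have hm : Measurable (fun w : Ω × Stream'.Seq A => (([], w) : State A M Ω)) :=
        measurable_const.prodMk measurable_id
      exact (ae_map_iff hm.aemeasurable (measurableSet_fst_preimage {l | l.length = 0})).2
        (Filter.Eventually.of_forall fun _ => rfl)
    | succ n ih =>
      rw [Game.stageLaw]
      have hS : MeasurableSet {x : State A M Ω | ¬ x.1.length = n + 1} :=
        measurableSet_fst_preimage {l | ¬ l.length = n + 1}
      rw [ae_iff, Measure.bind_apply hS (measurable_step G lam a.strategy).aemeasurable]
      refine (lintegral_eq_zero_iff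
        ((Measure.measurable_coe hS).comp (measurable_step G lam a.strategy))).2 ?_
      filter_upwards [ih] with x hx
      have hsub : {z : State A M Ω | ¬ z.1.length = n + 1} ⊆ {z | ¬ ∃ m, z.1 = x.1 ++ [m]} := by
        rintro z hz ⟨m, hm⟩
        exact hz (by rw [hm, List.length_append, hx]; rfl)
      exact measure_mono_null hsub (G.step_extends lam a.strategy x)
  have hnull : ∀ᵐ x ∂(G.stageLaw lam a.strategy i),
      ∀ h : List M, ¬ 0 < G.mass lam a.strategy h → h.length = i → x.1 ≠ h := by
    refine ae_all_iff.2 fun h => ?_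
    by_cases hh : ¬ 0 < G.mass lam a.strategy h ∧ h.length = i
    · obtain ⟨hm, rfl⟩ := hh
      have h1 : G.mass lam a.strategy h = 0 := le_antisymm (not_lt.1 hm) G.mass_nonneg
      rw [Game.mass, measureReal_eq_zero_iff, G.node_apply lam _ h MeasurableSet.univ,
        Set.preimage_univ, Set.inter_univ] at h1
      filter_upwards [measure_eq_zero_iff_ae_notMem.1 h1] with x hx _ _ using hx
    · exact Filter.Eventually.of_forall fun x h1 h2 => absurd ⟨h1, h2⟩ hh
  refine lintegral_eq_zero_of_ae_eq_zero ?_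
  filter_upwards [hlen i, hnull] with x hx1 hx2
  have hm : 0 < G.mass lam a.strategy x.1 := by
    by_contra hm
    exact hx2 x.1 hm hx1 rfl
  simp [G.work_eq_zero hlam hnot x.1 hm]

end

end MediatedLearning
end

theorem theorem1 (R P c : ℝ) (hc : 0 < c) (lam : unitInterval) (hlam : 0 < lam) :
    ∃ F : ℕ → ℝ, (∀ k, 1 ≤ k → 0 < F k) ∧
      ∀ (A M Ω : Type*) [Fintype A] [Fintype M] [Nonempty M] [MeasurableSpace M]
        [DiscreteMeasurableSpace M] [MeasurableSpace Ω]
        (G : MediatedLearning.Game A M Ω R P) (a : MediatedLearning.Assessment A M Ω),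
        (∀ i, G.NonEthical i) → G.IsWeakPBE c lam a →
          ((∃ k, 1 ≤ k ∧ G.atLeast k < F k) → ¬ G.Informative lam a) ∧
          ((∃ K : ℕ, G.atLeast K = 0) → ¬ G.Informative lam a) := by
  choose F hF hFall using fun j => MediatedLearning.exists_threshold R P c hc lam hlam j
  refine ⟨fun k => F (k - 1), fun k _ => hF _, ?_⟩
  intro A M Ω _ _ _ _ _ _ G a hne ha
  have main : ∀ j, G.atLeast (j + 1) < F j → ¬ G.Informative lam a := by
    intro j hj hinf
    have h1 := hFall j A M Ω G a hne ha [] (by rw [G.mass_nil]; exact one_pos)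
      (hinf.peril_pos hlam)
    rw [G.mass_nil, G.massMore_nil, mul_one] at h1
    exact absurd hj (not_lt.2 h1)
  constructor
  · rintro ⟨k, hk, hlt⟩
    obtain ⟨j, rfl⟩ := Nat.exists_eq_add_of_le' hk
    exact main j hlt
  · rintro ⟨K, hK⟩
    rcases K with _ | j
    · -- there are always at least `0` signals
      simp [MediatedLearning.Game.atLeast] at hK
    · exact main j (hK ▸ hF j)
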